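/- **Theorem (Extension operator).** Let $d\ge 1$, $T_{\mathrm{end}}>0$, let $\Omega\subset\mathbb R^d$ be a bounded Lipschitz domain and $Q=(0,T_{\mathrm{end}})\times\Omega$. Write $L=L^2(Q)\times L^2(Q;\mathbb R^d)$ with its product Hilbert norm $\|\cdot\|_{L^2(Q)}$, put $\operatorname{div}(v,\tau)=\partial_t v+\operatorname{div}_x\tau$, and, with weak derivatives, $$A(v,\tau)=\big(\operatorname{div}(v,\tau),\ \nabla_x v+\tau\big),\qquad A^*(w,\chi)=\big(-\operatorname{div}(w,\chi),\ -\nabla_x w+\chi\big).$$ Let $U_0$ be the set of all $\mathbf v=(v,\tau)\in L$ with $\nabla_x v\in L^2(Q;\mathbb R^d)$, $\operatorname{div}(v,\tau)\in L^2(Q)$ and $\langle\nabla_x v,\chi\rangle_{L^2(Q)}=-\langle v,\operatorname{div}_x\chi\rangle_{L^2(Q)}$ for all $\chi\in C^\infty(\overline Q;\mathbb R^d)$. For $\mathbf v=(v,\tau)\in U_0$ let $\gamma_0\mathbf v=v(0,\cdot)\in L^2(\Omega)$ be the value at time $0$ of the representative of $v$ in $C([0,T_{\mathrm{end}}];L^2(\Omega))$,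 and put $\|\mathbf v\|_{H(A,Q)}^2=\|\mathbf v\|_{L^2(Q)}^2+\|A\mathbf v\|_{L^2(Q)}^2$. Let $\mathcal T$ be a finite partition of $Q$, that is, a finite family of pairwise disjoint open cells $K\subset Q$ that cover $Q$ up to a set of measure zero. Let $H(A^*,\mathcal T)$ be the set of all $\mathbf w=(w,\chi)\in L$ such that $\operatorname{div}(w,\chi)\in L^2(K)$ and $\nabla_x w\in L^2(K;\mathbb R^d)$ on every $K\in\mathcal T$, let $A_h^*$ be the cell-wise application of $A^*$, and let $Y=H(A^*,\mathcal T)\times L^2(\Omega)$ be the Hilbert space with the inner product $$\langle(\mathbf w,\xi),(\widetilde{\mathbf w},\tilde\xi)\rangle_Y=\langle\mathbf w,\widetilde{\mathbf w}\rangle_{L^2(Q)}+\langle A_h^*\mathbf w,A_h^*\widetilde{\mathbf w}\rangle_{L^2(Q)}+\langle\xi,\tilde\xi\rangle_{L^2(\Omega)}.$$ For $\mathbf v\in U_0$ define $\gamma_A\mathbf v\in Y^*$ by $$\langle\gamma_A\mathbf v,(\mathbf w,\xi)\rangle=\langle A\mathbf v,\mathbf w\rangle_{L^2(Q)}-\langle\mathbf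 v,A_h^*\mathbf w\rangle_{L^2(Q)}+\langle\gamma_0\mathbf v,\xi\rangle_{L^2(\Omega)},$$ and set $\Gamma=\gamma_A U_0\subset Y^*$ and $X=L\times\Gamma$. For $(\mathbf v,\mathbf t)\in X$ and $(\mathbf w,\xi)\in Y$ let $b(\mathbf v,\mathbf t;\mathbf w,\xi)=\langle\mathbf v,A_h^*\mathbf w\rangle_{L^2(Q)}+\langle\mathbf t,(\mathbf w,\xi)\rangle$. Let $T(\mathbf v,\mathbf t)=(T_1(\mathbf v,\mathbf t),T_2(\mathbf v,\mathbf t))\in Y$ be the Riesz representative of $b(\mathbf v,\mathbf t;\cdot)\in Y^*$, and put $\mathcal E(\mathbf v,\mathbf t)=\mathbf v-A_h^*T_1(\mathbf v,\mathbf t)$. Then for all $(\mathbf v,\mathbf t)\in X$: 1. $\mathcal E(\mathbf v,\mathbf t)\in U_0$ and $A\,\mathcal E(\mathbf v,\mathbf t)=T_1(\mathbf v,\mathbf t)$; 2. $\gamma_A\mathcal E(\mathbf v,\mathbf t)=\mathbf t$; 3. $\|b(\mathbf v,\mathbf t;\cdot)\|_{Y^*}^2=\|\mathbf v-\mathcal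 E(\mathbf v,\mathbf t)\|_{L^2(Q)}^2+\|A\,\mathcal E(\mathbf v,\mathbf t)\|_{L^2(Q)}^2+\|\gamma_0\mathcal E(\mathbf v,\mathbf t)\|_{L^2(\Omega)}^2$; 4. $\|\mathcal E(0,\mathbf t)\|_{H(A,Q)}=\min\{\|\mathbf q\|_{H(A,Q)} : \mathbf q\in U_0,\ \gamma_A\mathbf q=\mathbf t\}$; 5. $\|\mathcal E(\mathbf v,0)\|_{H(A,Q)}\le\|\mathbf v\|_{L^2(Q)}$; 6. $\|\mathcal E(\mathbf v,\mathbf t)\|_{H(A,Q)}^2=\|\mathcal E(0,\mathbf t)\|_{H(A,Q)}^2+\|\mathcal E(\mathbf v,0)\|_{H(A,Q)}^2$. -/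

import Mathlib

open MeasureTheory Set Filter Topology
open scoped ContDiff

noncomputable section

namespace HeatDPG

/-- The space `ℝ^d` with its Euclidean structure. -/
abbrev Space (d : ℕ) := EuclideanSpace ℝ (Fin d)

/-- Points `(t, x)` of time-space. -/
abbrev TimeSpace (d : ℕ) := ℝ × EuclideanSpace ℝ (Fin d)

/-- A bounded Lipschitz domain: a bounded, open, connected (in particular nonempty) set which near
each of its boundary points is the region strictly above the graph of a Lipschitz function, in
suitable orthonormal coordinates; `e` is the unit vector of the vertical direction, and
`x - ⟪e, x⟫ e` are the horizontal coordinates of `x`. -/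
structure IsBoundedLipschitzDomain {d : ℕ} (Ω : Set (Space d)) : Prop where
  isOpen : IsOpen Ω
  isConnected : IsConnected Ω
  isBounded : Bornology.IsBounded Ω
  lipschitz_boundary : ∀ p ∈ frontier Ω, ∃ e : Space d, ‖e‖ = 1 ∧
    ∃ (C : NNReal) (φ : Space d → ℝ), LipschitzWith C φ ∧
      ∃ N ∈ 𝓝 p, ∀ x ∈ N, (x ∈ Ω ↔ φ (x - inner ℝ e x • e) < inner ℝ e x)

/-- The time-space cylinder `Q = (0, T) × Ω`. -/
def cylinder {d : ℕ} (T : ℝ) (Ω : Set (Space d)) : Set (TimeSpace d) := Ioo 0 T ×ˢ Ω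

/-! ### Classical derivatives of smooth functions -/

/-- `∂_t φ`. -/
def timeDeriv {d : ℕ} (φ : TimeSpace d → ℝ) (p : TimeSpace d) : ℝ :=
  fderiv ℝ φ p (1, 0)

/-- `∇_x φ`. -/
def gradX {d : ℕ} (φ : TimeSpace d → ℝ) (p : TimeSpace d) : Space d :=
  WithLp.toLp 2 fun i => fderiv ℝ φ p (0, EuclideanSpace.single i 1)

/-- `div_x χ`. -/
def divX {d : ℕ} (χ : TimeSpace d → Space d) (p : TimeSpace d) : ℝ :=
  ∑ i, fderiv ℝ χ p (0, EuclideanSpace.single i 1) i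

/-! ### Weak derivatives -/

/-- `g` is the weak gradient `∇_x v` on the open set `K`. -/
def HasWeakGradX {d : ℕ} (K : Set (TimeSpace d)) (v : TimeSpace d → ℝ)
    (g : TimeSpace d → Space d) : Prop :=
  ∀ φ : TimeSpace d → Space d, ContDiff ℝ ∞ φ → HasCompactSupport φ → tsupport φ ⊆ K →
    ∫ p in K, v p * divX φ p = - ∫ p in K, inner ℝ (g p) (φ p)

/-- `f` is the weak time-space divergence `div (v, τ) = ∂_t v + div_x τ` on the open set `K`. -/
def HasWeakDiv {d : ℕ} (K : Set (TimeSpace d)) (v : TimeSpace d → ℝ)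
    (τ : TimeSpace d → Space d) (f : TimeSpace d → ℝ) : Prop :=
  ∀ φ : TimeSpace d → ℝ, ContDiff ℝ ∞ φ → HasCompactSupport φ → tsupport φ ⊆ K →
    ∫ p in K, (v p * timeDeriv φ p + inner ℝ (τ p) (gradX φ p)) = - ∫ p in K, f p * φ p

/-- `L²(K; F)`. -/
abbrev L2 {α : Type*} [MeasureSpace α] (K : Set α) (F : Type*) [NormedAddCommGroup F] :=
  Lp F 2 (volume.restrict K)

/-- The Hilbert space `L²(K) × L²(K; ℝ^d)`, with
`‖(v, τ)‖² = ‖v‖² + ‖τ‖²`. -/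
abbrev L2Pair {d : ℕ} (K : Set (TimeSpace d)) := WithLp 2 (L2 K ℝ × L2 K (Space d))

open Classical in
/-- The weak gradient `∇_x v ∈ L²(K; ℝ^d)` on the open set `K`
(unique if it exists; the value is `0` if it does not exist). -/
def weakGradX {d : ℕ} (K : Set (TimeSpace d)) (v : TimeSpace d → ℝ) : L2 K (Space d) :=
  if h : ∃ g : L2 K (Space d), HasWeakGradX K v g then h.choose else 0

open Classical in
/-- The weak divergence `div (v, τ) ∈ L²(K)` on the open set `K`
(unique if it exists; the value is `0` if it does not exist). -/
def weakDiv {d : ℕ} (K : Set (TimeSpace d)) (v : TimeSpace d → ℝ)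
    (τ : TimeSpace d → Space d) : L2 K ℝ :=
  if h : ∃ f : L2 K ℝ, HasWeakDiv K v τ f then h.choose else 0

/-- For `(v, τ)` square integrable on `K`: the weak derivatives `∇_x v` and `div (v, τ)` on `K`
exist and are square integrable on `K`. This describes `H(A, K)` as well as `H(A^*, K)`. -/
def InGraphSpace {d : ℕ} (K : Set (TimeSpace d)) (v : TimeSpace d → ℝ)
    (τ : TimeSpace d → Space d) : Prop :=
  (∃ g : L2 K (Space d), HasWeakGradX K v g) ∧ (∃ f : L2 K ℝ, HasWeakDiv K v τ f)

/-! ### The operator `A` and the spaces `U`, `U₀` -/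

/-- `A (v, τ) = (div (v, τ), ∇_x v + τ)`. -/
def opA {d : ℕ} {Q : Set (TimeSpace d)} (v : L2Pair Q) : L2Pair Q :=
  WithLp.toLp 2 (weakDiv Q v.fst v.snd, weakGradX Q v.fst + v.snd)

/-- `U`, the pairs `(v, τ)` with `∇_x v` and `div (v, τ)` in `L²`. -/
def spaceU {d : ℕ} (Q : Set (TimeSpace d)) : Set (L2Pair Q) :=
  {v | InGraphSpace Q v.fst v.snd}

/-- `U₀`, the subset of all `(v, τ) ∈ U` with `⟨∇_x v, χ⟩ = - ⟨v, div_x χ⟩` for all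
smooth `χ` on the closure of `Q` (no condition on the support of `χ`). -/
def spaceU0 {d : ℕ} (Q : Set (TimeSpace d)) : Set (L2Pair Q) :=
  {v | v ∈ spaceU Q ∧ ∀ χ : TimeSpace d → Space d, ContDiff ℝ ∞ χ →
    ∫ p in Q, inner ℝ (weakGradX Q v.fst p) (χ p) = - ∫ p in Q, v.fst p * divX χ p}

/-- The graph norm `‖q‖_{H(A,Q)}`. -/
def graphNorm {d : ℕ} {Q : Set (TimeSpace d)} (q : L2Pair Q) : ℝ :=
  Real.sqrt (‖q‖ ^ 2 + ‖opA q‖ ^ 2)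

/-- `g = v(0, ·)`: the function `v` on `(0, T) × Ω` has a (necessarily unique)
representative in `C([0, T]; L²(Ω))`, and `g` is its value at time `0`. -/
def HasInitialTrace {d : ℕ} (T : ℝ) (Ω : Set (Space d)) (v : TimeSpace d → ℝ)
    (g : L2 Ω ℝ) : Prop :=
  ∃ u : ℝ → L2 Ω ℝ, ContinuousOn u (Icc 0 T) ∧
    (∀ᵐ t ∂(volume.restrict (Ioo 0 T)), u t =ᵐ[volume.restrict Ω] fun x => v (t, x)) ∧
    u 0 = g

open Classical in
/-- The trace `γ₀ (v, τ) = v(0, ·) ∈ L²(Ω)`; it exists for all `(v, τ) ∈ U₀`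
(the value is `0` if it does not exist). -/
def initialTrace {d : ℕ} {T : ℝ} {Ω : Set (Space d)} (v : L2Pair (cylinder T Ω)) : L2 Ω ℝ :=
  if h : ∃ g : L2 Ω ℝ, HasInitialTrace T Ω v.fst g then h.choose else 0

/-! ### Partitions and broken spaces -/

/-- A finite partition of (the closure of) `Q` into non-overlapping cells, each cell being
represented by its interior. -/
structure Mesh {d : ℕ} (Q : Set (TimeSpace d)) where
  card : ℕ
  cell : Fin card → Set (TimeSpace d)
  isOpen_cell : ∀ i, IsOpen (cell i)
  cell_subset : ∀ i, cell i ⊆ Q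
  disjoint_cell : Pairwise fun i j => Disjoint (cell i) (cell j)
  volume_diff : volume (Q \ ⋃ i, cell i) = 0

/-- Extension by zero `L²(K; F) → L²(Q; F)`, for measurable `K ⊆ Q`. -/
def zeroExt {d : ℕ} {F : Type*} [NormedAddCommGroup F] {K : Set (TimeSpace d)}
    (hK : MeasurableSet K) (Q : Set (TimeSpace d)) (f : L2 K F) : L2 Q F :=
  MemLp.toLp (K.indicator f) <| (memLp_indicator_iff_restrict hK).2 <|
    (Lp.memLp f).mono_measure <| by
      rw [Measure.restrict_restrict hK]
      exact Measure.restrict_mono inter_subset_left le_rfl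

/-- The element-wise application `A^*_h` of `A^* (w, χ) = (- div (w, χ), - ∇_x w + χ)`. -/
def brokenAstar {d : ℕ} {Q : Set (TimeSpace d)} (𝒯 : Mesh Q) (w : L2Pair Q) : L2Pair Q :=
  WithLp.toLp 2
    (∑ i, zeroExt (𝒯.isOpen_cell i).measurableSet Q (- weakDiv (𝒯.cell i) w.fst w.snd),
     (∑ i, zeroExt (𝒯.isOpen_cell i).measurableSet Q (- weakGradX (𝒯.cell i) w.fst)) + w.snd)

/-! ### Auxiliary facts: `A^*_h` is a closed linear operator -/

lemma continuous_timeDeriv {d : ℕ} {φ : TimeSpace d → ℝ} (h : ContDiff ℝ ∞ φ) :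
    Continuous (timeDeriv φ) :=
  (h.continuous_fderiv (by simp)).clm_apply continuous_const

lemma continuous_gradX {d : ℕ} {φ : TimeSpace d → ℝ} (h : ContDiff ℝ ∞ φ) :
    Continuous (gradX φ) :=
  (PiLp.continuous_toLp 2 _).comp <| continuous_pi fun _ =>
    (h.continuous_fderiv (by simp)).clm_apply continuous_const

lemma continuous_divX {d : ℕ} {χ : TimeSpace d → Space d} (h : ContDiff ℝ ∞ χ) :
    Continuous (divX χ) :=
  continuous_finsetSum _ fun i _ => (EuclideanSpace.proj (𝕜 := ℝ) i).continuous.comp <|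
    (h.continuous_fderiv (by simp)).clm_apply continuous_const

lemma hasCompactSupport_timeDeriv {d : ℕ} {φ : TimeSpace d → ℝ} (h : HasCompactSupport φ) :
    HasCompactSupport (timeDeriv φ) :=
  (h.fderiv ℝ).comp_left (g := fun L : TimeSpace d →L[ℝ] ℝ => L (1, 0)) (by simp)

lemma hasCompactSupport_gradX {d : ℕ} {φ : TimeSpace d → ℝ} (h : HasCompactSupport φ) :
    HasCompactSupport (gradX φ) :=
  (h.fderiv ℝ).comp_left (g := fun L : TimeSpace d →L[ℝ] ℝ =>
    (WithLp.toLp 2 fun i => L (0, EuclideanSpace.single i 1) : Space d)) (by ext; simp)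

lemma hasCompactSupport_divX {d : ℕ} {χ : TimeSpace d → Space d} (h : HasCompactSupport χ) :
    HasCompactSupport (divX χ) :=
  (h.fderiv ℝ).comp_left (g := fun L : TimeSpace d →L[ℝ] Space d =>
    ∑ i, L (0, EuclideanSpace.single i 1) i) (by simp)

lemma memLp_restrict {d : ℕ} {F : Type*} [NormedAddCommGroup F] {K Q : Set (TimeSpace d)} (hKQ : K ⊆ Q) (v : L2 Q F) :
    MemLp v 2 (volume.restrict K) :=
  (Lp.memLp v).mono_measure (Measure.restrict_mono hKQ le_rfl)

section Functionals

variable {d : ℕ} {F : Type*} [NormedAddCommGroup F] [InnerProductSpace ℝ F]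

lemma integrable_inner_test {K : Set (TimeSpace d)} {v ψ : TimeSpace d → F}
    (hv : MemLp v 2 (volume.restrict K)) (hψ : Continuous ψ) (hc : HasCompactSupport ψ) :
    Integrable (fun p => inner ℝ (v p) (ψ p)) (volume.restrict K) := by
  have hψ' : MemLp ψ 2 (volume.restrict K) := hψ.memLp_of_hasCompactSupport hc
  have h := L2.integrable_inner (𝕜 := ℝ) (hv.toLp v) (hψ'.toLp ψ)
  refine h.congr ?_
  filter_upwards [hv.coeFn_toLp, hψ'.coeFn_toLp] with p h1 h2
  rw [h1, h2]

/-- The functional `v ↦ ∫_K v · ψ` on `L²(Q; F)`. -/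
lemma exists_clm_test {K Q : Set (TimeSpace d)} (hK : MeasurableSet K) (hKQ : K ⊆ Q)
    {ψ : TimeSpace d → F} (hψ : Continuous ψ) (hc : HasCompactSupport ψ) :
    ∃ ℓ : L2 Q F →L[ℝ] ℝ, ∀ v, ℓ v = ∫ p in K, inner ℝ (v p) (ψ p) := by
  have hψ' : MemLp (K.indicator ψ) 2 (volume.restrict Q) :=
    MemLp.indicator hK (hψ.memLp_of_hasCompactSupport hc)
  refine ⟨innerSL ℝ (hψ'.toLp _), fun v => ?_⟩
  rw [innerSL_apply_apply, real_inner_comm, MeasureTheory.L2.inner_def]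
  have h1 : ∫ p in Q, inner ℝ (v p) (hψ'.toLp _ p)
      = ∫ p in Q, K.indicator (fun p => inner ℝ (v p) (ψ p)) p := by
    refine integral_congr_ae ?_
    filter_upwards [hψ'.coeFn_toLp] with p hp
    rw [hp]
    by_cases h : p ∈ K <;> simp [h]
  rw [h1, integral_indicator hK, Measure.restrict_restrict hK, inter_eq_left.2 hKQ]

end Functionals

lemma HasWeakGradX.congr {d : ℕ} {K : Set (TimeSpace d)} {v : TimeSpace d → ℝ}
    {g g' : TimeSpace d → Space d} (h : HasWeakGradX K v g) (hg : g =ᵐ[volume.restrict K] g') :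
    HasWeakGradX K v g' := by
  intro φ h1 h2 h3
  rw [h φ h1 h2 h3]
  congr 1
  refine integral_congr_ae ?_
  filter_upwards [hg] with p hp
  rw [hp]

lemma HasWeakDiv.congr {d : ℕ} {K : Set (TimeSpace d)} {v : TimeSpace d → ℝ}
    {τ : TimeSpace d → Space d} {f f' : TimeSpace d → ℝ} (h : HasWeakDiv K v τ f)
    (hf : f =ᵐ[volume.restrict K] f') : HasWeakDiv K v τ f' := by
  intro φ h1 h2 h3
  rw [h φ h1 h2 h3]
  congr 1
  refine integral_congr_ae ?_
  filter_upwards [hf] with p hp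
  rw [hp]

lemma inner_eq_mul (a b : ℝ) : inner ℝ a b = a * b := by
  simp [mul_comm]

lemma ae_eq_of_test {d : ℕ} {F : Type*} [NormedAddCommGroup F] [InnerProductSpace ℝ F]
    [CompleteSpace F] {K : Set (TimeSpace d)} (hK : IsOpen K) {g g' : TimeSpace d → F}
    (hg : MemLp g 2 (volume.restrict K)) (hg' : MemLp g' 2 (volume.restrict K))
    (h : ∀ η : TimeSpace d → ℝ, ContDiff ℝ ∞ η → HasCompactSupport η → tsupport η ⊆ K →
      ∀ c : F, ∫ p in K, inner ℝ (g p) (η p • c) = ∫ p in K, inner ℝ (g' p) (η p • c)) :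
    g =ᵐ[volume.restrict K] g' := by
  have hloc : LocallyIntegrableOn (fun p => g p - g' p) K := by
    refine (locallyIntegrableOn_iff hK.isLocallyClosed).2 fun C hCK hC => ?_
    have := (hg.sub hg').mono_measure (Measure.restrict_mono hCK le_rfl)
    have hfin : IsFiniteMeasure (volume.restrict C) := ⟨by simpa using hC.measure_lt_top⟩
    exact this.integrable (by norm_num)
  have key := hK.ae_eq_zero_of_integral_contDiff_smul_eq_zero hloc ?_
  · rw [Filter.EventuallyEq, ae_restrict_iff' hK.measurableSet]
    filter_upwards [key] with p hp hpK
    exact sub_eq_zero.1 (hp hpK)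
  intro η h1 h2 h3
  have hset : ∫ p, η p • (g p - g' p) = ∫ p in K, η p • (g p - g' p) := by
    refine (setIntegral_eq_integral_of_forall_compl_eq_zero fun p hp => ?_).symm
    rw [image_eq_zero_of_notMem_tsupport fun h => hp (h3 h), zero_smul]
  have hint : ∀ u : TimeSpace d → F, MemLp u 2 (volume.restrict K) →
      Integrable (fun p => η p • u p) (volume.restrict K) := fun u hu => by
    have h := MemLp.smul (r := 1) hu
      (h1.continuous.memLp_of_hasCompactSupport (p := 2) (μ := volume.restrict K) h2)
    exact memLp_one_iff_integrable.1 h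
  rw [hset, ← inner_self_eq_zero (𝕜 := ℝ)]
  set c := ∫ p in K, η p • (g p - g' p) with hc
  have e1 : ∀ u : TimeSpace d → F, MemLp u 2 (volume.restrict K) →
      inner ℝ c (∫ p in K, η p • u p) = ∫ p in K, inner ℝ (u p) (η p • c) := fun u hu => by
    rw [← integral_inner (hint u hu)]
    refine integral_congr_ae (Eventually.of_forall fun p => ?_)
    simp only [inner_smul_right, real_inner_comm]
  have e2 : c = (∫ p in K, η p • g p) - ∫ p in K, η p • g' p := by
    rw [hc, ← integral_sub (hint g hg) (hint g' hg')]
    simp only [smul_sub]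
  nth_rewrite 2 [e2]
  rw [inner_sub_right, e1 g hg, e1 g' hg', h η h1 h2 h3 c, sub_self]

lemma HasWeakGradX.unique {d : ℕ} {K : Set (TimeSpace d)} (hK : IsOpen K) {v : TimeSpace d → ℝ}
    {g g' : TimeSpace d → Space d} (hg : MemLp g 2 (volume.restrict K))
    (hg' : MemLp g' 2 (volume.restrict K)) (h : HasWeakGradX K v g) (h' : HasWeakGradX K v g') :
    g =ᵐ[volume.restrict K] g' := by
  refine ae_eq_of_test hK hg hg' fun η h1 h2 h3 c => ?_
  have hs : tsupport (fun p => η p • c) ⊆ K := (closure_mono fun p hp => by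
    simp only [Function.mem_support] at hp ⊢
    exact fun h => hp (by simp [h])).trans h3
  have k1 := h _ (h1.smul contDiff_const) (h2.smul_right (f' := fun _ => c)) hs
  have k2 := h' _ (h1.smul contDiff_const) (h2.smul_right (f' := fun _ => c)) hs
  exact neg_injective (k1.symm.trans k2)

lemma HasWeakDiv.unique {d : ℕ} {K : Set (TimeSpace d)} (hK : IsOpen K) {v : TimeSpace d → ℝ}
    {τ : TimeSpace d → Space d} {f f' : TimeSpace d → ℝ} (hf : MemLp f 2 (volume.restrict K))
    (hf' : MemLp f' 2 (volume.restrict K)) (h : HasWeakDiv K v τ f) (h' : HasWeakDiv K v τ f') :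
    f =ᵐ[volume.restrict K] f' := by
  refine ae_eq_of_test hK hf hf' fun η h1 h2 h3 c => ?_
  have k := neg_injective ((h η h1 h2 h3).symm.trans (h' η h1 h2 h3))
  have e : ∀ u : TimeSpace d → ℝ,
      ∫ p in K, inner ℝ (u p) (η p • c) = c * ∫ p in K, u p * η p := fun u => by
    rw [← integral_const_mul]
    refine integral_congr_ae (Eventually.of_forall fun p => ?_)
    simp only [RCLike.inner_apply, smul_eq_mul, conj_trivial]
    ring
  rw [e, e, k]

lemma weakGradX_spec {d : ℕ} {K : Set (TimeSpace d)} {v : TimeSpace d → ℝ}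
    (h : ∃ g : L2 K (Space d), HasWeakGradX K v g) : HasWeakGradX K v (weakGradX K v) := by
  rw [weakGradX, dif_pos h]
  exact h.choose_spec

lemma weakDiv_spec {d : ℕ} {K : Set (TimeSpace d)} {v : TimeSpace d → ℝ}
    {τ : TimeSpace d → Space d} (h : ∃ f : L2 K ℝ, HasWeakDiv K v τ f) :
    HasWeakDiv K v τ (weakDiv K v τ) := by
  rw [weakDiv, dif_pos h]
  exact h.choose_spec

section Broken

variable {d : ℕ} {Q : Set (TimeSpace d)} (𝒯 : Mesh Q)

/-- `z` is cell by cell the image of `w` under `A^*`. -/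
def IsBrokenAstar (w z : L2Pair Q) : Prop :=
  ∀ i, HasWeakDiv (𝒯.cell i) w.fst w.snd (fun p => - z.fst p) ∧
    HasWeakGradX (𝒯.cell i) w.fst (fun p => w.snd p - z.snd p)

lemma sum_zeroExt_ae {F : Type*} [NormedAddCommGroup F] (f : ∀ i, L2 (𝒯.cell i) F)
    (i : Fin 𝒯.card) :
    (∑ j, zeroExt (𝒯.isOpen_cell j).measurableSet Q (f j) : L2 Q F)
      =ᵐ[volume.restrict (𝒯.cell i)] f i := by
  have hle : volume.restrict (𝒯.cell i) ≤ volume.restrict Q :=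
    Measure.restrict_mono (𝒯.cell_subset i) le_rfl
  have h1 := ae_mono hle (Lp.coeFn_fun_finsetSum (p := 2) Finset.univ
    fun j => zeroExt (𝒯.isOpen_cell j).measurableSet Q (f j))
  have h2 : ∀ᵐ p ∂(volume.restrict (𝒯.cell i)), ∀ j,
      zeroExt (𝒯.isOpen_cell j).measurableSet Q (f j) p = (𝒯.cell j).indicator (f j) p :=
    ae_all_iff.2 fun j => ae_mono hle (MemLp.coeFn_toLp _)
  filter_upwards [h1, h2, ae_restrict_mem (𝒯.isOpen_cell i).measurableSet] with p k1 k2 k3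
  rw [k1, Finset.sum_eq_single i, k2, indicator_of_mem k3]
  · intro j _ hj
    rw [k2, indicator_of_notMem]
    exact fun h => Set.disjoint_left.1 (𝒯.disjoint_cell hj) h k3
  · simp

lemma ae_eq_of_cells {F : Type*} [NormedAddCommGroup F] {f g : L2 Q F}
    (h : ∀ i, f =ᵐ[volume.restrict (𝒯.cell i)] g) : f = g := by
  refine Lp.ext ?_
  have h1 : ∀ᵐ p ∂(volume.restrict (⋃ i, 𝒯.cell i)), f p = g p :=
    (ae_restrict_iUnion_iff _ _).2 h
  have hsub : (⋃ i, 𝒯.cell i) ⊆ Q := iUnion_subset 𝒯.cell_subset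
  have h2 : volume.restrict (⋃ i, 𝒯.cell i) = volume.restrict Q := by
    refine Measure.restrict_congr_set ?_
    exact (hsub.eventuallyLE).antisymm (ae_le_set.2 𝒯.volume_diff)
  rwa [h2] at h1

lemma isBrokenAstar_brokenAstar {w : L2Pair Q}
    (h : ∀ i, InGraphSpace (𝒯.cell i) w.fst w.snd) : IsBrokenAstar 𝒯 w (brokenAstar 𝒯 w) := by
  intro i
  constructor
  · refine (weakDiv_spec (h i).2).congr ?_
    filter_upwards [sum_zeroExt_ae 𝒯 (fun i => - weakDiv (𝒯.cell i) w.fst w.snd) i,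
      Lp.coeFn_neg (weakDiv (𝒯.cell i) w.fst w.snd)] with p k1 k2
    change _ = - (∑ j, zeroExt (𝒯.isOpen_cell j).measurableSet Q
      (- weakDiv (𝒯.cell j) w.fst w.snd) : L2 Q ℝ) p
    rw [k1, k2, Pi.neg_apply, neg_neg]
  · refine (weakGradX_spec (h i).1).congr ?_
    have hle : volume.restrict (𝒯.cell i) ≤ volume.restrict Q :=
      Measure.restrict_mono (𝒯.cell_subset i) le_rfl
    filter_upwards [sum_zeroExt_ae 𝒯 (fun i => - weakGradX (𝒯.cell i) w.fst) i,
      Lp.coeFn_neg (weakGradX (𝒯.cell i) w.fst),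
      ae_mono hle (Lp.coeFn_add (∑ j, zeroExt (𝒯.isOpen_cell j).measurableSet Q
        (- weakGradX (𝒯.cell j) w.fst) : L2 Q (Space d)) w.snd)] with p k1 k2 k3
    change _ = w.snd p - ((∑ j, zeroExt (𝒯.isOpen_cell j).measurableSet Q
      (- weakGradX (𝒯.cell j) w.fst)) + w.snd : L2 Q (Space d)) p
    rw [k3, Pi.add_apply, k1, k2, Pi.neg_apply]
    abel

lemma IsBrokenAstar.inGraphSpace {w z : L2Pair Q} (h : IsBrokenAstar 𝒯 w z) (i : Fin 𝒯.card) :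
    InGraphSpace (𝒯.cell i) w.fst w.snd := by
  have m1 := (memLp_restrict (𝒯.cell_subset i) z.fst).neg
  have m2 := (memLp_restrict (𝒯.cell_subset i) w.snd).sub
    (memLp_restrict (𝒯.cell_subset i) z.snd)
  exact ⟨⟨m2.toLp _, (h i).2.congr m2.coeFn_toLp.symm⟩,
    ⟨m1.toLp _, (h i).1.congr m1.coeFn_toLp.symm⟩⟩

lemma IsBrokenAstar.eq {w z : L2Pair Q} (h : IsBrokenAstar 𝒯 w z) : brokenAstar 𝒯 w = z := by
  have h' := isBrokenAstar_brokenAstar 𝒯 h.inGraphSpace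
  have m1 : ∀ (y : L2Pair Q) i, MemLp (fun p => - y.fst p) 2 (volume.restrict (𝒯.cell i)) :=
    fun y i => (memLp_restrict (𝒯.cell_subset i) y.fst).neg
  have m2 : ∀ (y : L2Pair Q) i,
      MemLp (fun p => w.snd p - y.snd p) 2 (volume.restrict (𝒯.cell i)) :=
    fun y i => (memLp_restrict (𝒯.cell_subset i) w.snd).sub
      (memLp_restrict (𝒯.cell_subset i) y.snd)
  have e1 : (brokenAstar 𝒯 w).fst = z.fst := ae_eq_of_cells 𝒯 fun i => by
    filter_upwards [HasWeakDiv.unique (𝒯.isOpen_cell i) (m1 _ i) (m1 _ i) (h' i).1 (h i).1]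
      with p hp
    exact neg_injective hp
  have e2 : (brokenAstar 𝒯 w).snd = z.snd := ae_eq_of_cells 𝒯 fun i => by
    filter_upwards [HasWeakGradX.unique (𝒯.isOpen_cell i) (m2 _ i) (m2 _ i) (h' i).2 (h i).2]
      with p hp
    exact sub_right_injective hp
  exact (WithLp.ofLp_injective 2) (Prod.ext e1 e2)

/-- The graph of `A^*_h` is cut out by continuous linear functionals. -/
lemma exists_functionals : ∃ S : Set (L2Pair Q × L2Pair Q →L[ℝ] ℝ),
    ∀ w z : L2Pair Q, IsBrokenAstar 𝒯 w z ↔ ∀ ℓ ∈ S, ℓ (w, z) = 0 := by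
  let P1 : L2Pair Q →L[ℝ] L2 Q ℝ := WithLp.fstL 2 ℝ _ _
  let P2 : L2Pair Q →L[ℝ] L2 Q (Space d) := WithLp.sndL 2 ℝ _ _
  let W := ContinuousLinearMap.fst ℝ (L2Pair Q) (L2Pair Q)
  let Z := ContinuousLinearMap.snd ℝ (L2Pair Q) (L2Pair Q)
  have D : ∀ (i : Fin 𝒯.card) (φ : TimeSpace d → ℝ), ContDiff ℝ ∞ φ → HasCompactSupport φ →
      ∃ ℓ : L2Pair Q × L2Pair Q →L[ℝ] ℝ, ∀ w z : L2Pair Q, ℓ (w, z) = 0 ↔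
        ∫ p in 𝒯.cell i, (w.fst p * timeDeriv φ p + inner ℝ (w.snd p) (gradX φ p))
          = - ∫ p in 𝒯.cell i, (- z.fst p) * φ p := by
    intro i φ h1 h2
    have hm := (𝒯.isOpen_cell i).measurableSet
    obtain ⟨a, ha⟩ := exists_clm_test hm (𝒯.cell_subset i) (continuous_timeDeriv h1)
      (hasCompactSupport_timeDeriv h2)
    obtain ⟨b, hb⟩ := exists_clm_test hm (𝒯.cell_subset i) (continuous_gradX h1)
      (hasCompactSupport_gradX h2)
    obtain ⟨c, hc⟩ := exists_clm_test hm (𝒯.cell_subset i) h1.continuous h2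
    refine ⟨a.comp (P1.comp W) + b.comp (P2.comp W) - c.comp (P1.comp Z), fun w z => ?_⟩
    have e : (a.comp (P1.comp W) + b.comp (P2.comp W) - c.comp (P1.comp Z)) (w, z)
        = a w.fst + b w.snd - c z.fst := rfl
    rw [e, ha, hb, hc, ← integral_add
      (integrable_inner_test (memLp_restrict (𝒯.cell_subset i) w.fst) (continuous_timeDeriv h1)
        (hasCompactSupport_timeDeriv h2))
      (integrable_inner_test (memLp_restrict (𝒯.cell_subset i) w.snd) (continuous_gradX h1)
        (hasCompactSupport_gradX h2)), sub_eq_zero, ← integral_neg]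
    simp only [inner_eq_mul, neg_mul, neg_neg]
  have G : ∀ (i : Fin 𝒯.card) (φ : TimeSpace d → Space d), ContDiff ℝ ∞ φ →
      HasCompactSupport φ →
      ∃ ℓ : L2Pair Q × L2Pair Q →L[ℝ] ℝ, ∀ w z : L2Pair Q, ℓ (w, z) = 0 ↔
        ∫ p in 𝒯.cell i, w.fst p * divX φ p
          = - ∫ p in 𝒯.cell i, inner ℝ (w.snd p - z.snd p) (φ p) := by
    intro i φ h1 h2
    have hm := (𝒯.isOpen_cell i).measurableSet
    obtain ⟨a, ha⟩ := exists_clm_test hm (𝒯.cell_subset i) (continuous_divX h1)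
      (hasCompactSupport_divX h2)
    obtain ⟨b, hb⟩ := exists_clm_test hm (𝒯.cell_subset i) h1.continuous h2
    refine ⟨a.comp (P1.comp W) + (b.comp (P2.comp W) - b.comp (P2.comp Z)), fun w z => ?_⟩
    have e : (a.comp (P1.comp W) + (b.comp (P2.comp W) - b.comp (P2.comp Z))) (w, z)
        = a w.fst + (b w.snd - b z.snd) := rfl
    rw [e, ha, hb, hb, ← integral_sub
      (integrable_inner_test (memLp_restrict (𝒯.cell_subset i) w.snd) h1.continuous h2)
      (integrable_inner_test (memLp_restrict (𝒯.cell_subset i) z.snd) h1.continuous h2),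
      add_eq_zero_iff_eq_neg]
    simp only [inner_eq_mul, inner_sub_left]
  choose D1 D2 using D
  choose G1 G2 using G
  refine ⟨{ℓ | ∃ i, (∃ φ h1 h2, tsupport φ ⊆ 𝒯.cell i ∧ ℓ = D1 i φ h1 h2) ∨
    (∃ φ h1 h2, tsupport φ ⊆ 𝒯.cell i ∧ ℓ = G1 i φ h1 h2)}, fun w z => ⟨?_, ?_⟩⟩
  · rintro h ℓ ⟨i, ⟨φ, h1, h2, h3, rfl⟩ | ⟨φ, h1, h2, h3, rfl⟩⟩
    · exact (D2 i φ h1 h2 w z).2 ((h i).1 φ h1 h2 h3)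
    · exact (G2 i φ h1 h2 w z).2 ((h i).2 φ h1 h2 h3)
  · intro h i
    exact ⟨fun φ h1 h2 h3 => (D2 i φ h1 h2 w z).1 (h _ ⟨i, Or.inl ⟨φ, h1, h2, h3, rfl⟩⟩),
      fun φ h1 h2 h3 => (G2 i φ h1 h2 w z).1 (h _ ⟨i, Or.inr ⟨φ, h1, h2, h3, rfl⟩⟩)⟩

lemma IsBrokenAstar.zero : IsBrokenAstar 𝒯 0 0 := by
  obtain ⟨S, hS⟩ := exists_functionals 𝒯
  exact (hS _ _).2 fun ℓ _ => ℓ.map_zero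

lemma IsBrokenAstar.add {w z w' z' : L2Pair Q} (h : IsBrokenAstar 𝒯 w z)
    (h' : IsBrokenAstar 𝒯 w' z') : IsBrokenAstar 𝒯 (w + w') (z + z') := by
  obtain ⟨S, hS⟩ := exists_functionals 𝒯
  refine (hS _ _).2 fun ℓ hℓ => ?_
  rw [← Prod.mk_add_mk, map_add, (hS _ _).1 h ℓ hℓ, (hS _ _).1 h' ℓ hℓ, add_zero]

lemma IsBrokenAstar.smul {w z : L2Pair Q} (h : IsBrokenAstar 𝒯 w z) (c : ℝ) :
    IsBrokenAstar 𝒯 (c • w) (c • z) := by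
  obtain ⟨S, hS⟩ := exists_functionals 𝒯
  refine (hS _ _).2 fun ℓ hℓ => ?_
  rw [← Prod.smul_mk, map_smul, (hS _ _).1 h ℓ hℓ, smul_zero]

lemma IsBrokenAstar.of_tendsto {w z : ℕ → L2Pair Q} {w' z' : L2Pair Q}
    (h : ∀ n, IsBrokenAstar 𝒯 (w n) (z n)) (hw : Tendsto w atTop (𝓝 w'))
    (hz : Tendsto z atTop (𝓝 z')) : IsBrokenAstar 𝒯 w' z' := by
  obtain ⟨S, hS⟩ := exists_functionals 𝒯
  refine (hS _ _).2 fun ℓ hℓ => ?_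
  have h1 := (ℓ.continuous.tendsto (w', z')).comp (hw.prodMk_nhds hz)
  refine tendsto_nhds_unique h1 (tendsto_const_nhds.congr fun n => ?_)
  exact ((hS _ _).1 (h n) ℓ hℓ).symm

/-! ### The broken test space `Y` -/

/-- The space `H(A^*, 𝒯)` of broken functions. -/
def brokenSpace : Submodule ℝ (L2Pair Q) where
  carrier := {w | ∀ i, InGraphSpace (𝒯.cell i) w.fst w.snd}
  zero_mem' := (IsBrokenAstar.zero 𝒯).inGraphSpace
  add_mem' h h' := ((isBrokenAstar_brokenAstar 𝒯 h).add 𝒯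
    (isBrokenAstar_brokenAstar 𝒯 h')).inGraphSpace
  smul_mem' c _ h := ((isBrokenAstar_brokenAstar 𝒯 h).smul 𝒯 c).inGraphSpace

/-- The linear operator `A^*_h : H(A^*, 𝒯) → L²(Q) × L²(Q; ℝ^d)`. -/
def brokenAstarLin : brokenSpace 𝒯 →ₗ[ℝ] L2Pair Q where
  toFun w := brokenAstar 𝒯 w
  map_add' w w' := ((isBrokenAstar_brokenAstar 𝒯 w.2).add 𝒯
    (isBrokenAstar_brokenAstar 𝒯 w'.2)).eq
  map_smul' c w := ((isBrokenAstar_brokenAstar 𝒯 w.2).smul 𝒯 c).eq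

end Broken

section TestSpace

variable {d : ℕ} {T : ℝ} {Ω : Set (Space d)} (𝒯 : Mesh (cylinder T Ω))

/-- The test space `Y = H(A^*, 𝒯) × L²(Ω)`. -/
def TestSpace := brokenSpace 𝒯 × L2 Ω ℝ

namespace TestSpace

instance instAddCommGroup : AddCommGroup (TestSpace 𝒯) :=
  inferInstanceAs (AddCommGroup (brokenSpace 𝒯 × L2 Ω ℝ))

instance instModule : Module ℝ (TestSpace 𝒯) :=
  inferInstanceAs (Module ℝ (brokenSpace 𝒯 × L2 Ω ℝ))

/-- The component `w` of `(w, ξ) ∈ Y`, as an element of `L²(Q) × L²(Q; ℝ^d)`. -/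
def fnLin : TestSpace 𝒯 →ₗ[ℝ] L2Pair (cylinder T Ω) :=
  (brokenSpace 𝒯).subtype ∘ₗ LinearMap.fst ℝ (brokenSpace 𝒯) (L2 Ω ℝ)

/-- `(w, ξ) ↦ A^*_h w`. -/
def astarLin : TestSpace 𝒯 →ₗ[ℝ] L2Pair (cylinder T Ω) :=
  brokenAstarLin 𝒯 ∘ₗ LinearMap.fst ℝ (brokenSpace 𝒯) (L2 Ω ℝ)

/-- The component `ξ` of `(w, ξ) ∈ Y`. -/
def initLin : TestSpace 𝒯 →ₗ[ℝ] L2 Ω ℝ := LinearMap.snd ℝ (brokenSpace 𝒯) (L2 Ω ℝ)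

/-- The inner product
`⟨(w, ξ), (w', ξ')⟩_Y = ⟨w, w'⟩ + ⟨A^*_h w, A^*_h w'⟩ + ⟨ξ, ξ'⟩`. -/
instance instCore : InnerProductSpace.Core ℝ (TestSpace 𝒯) where
  inner y y' := inner ℝ (fnLin 𝒯 y) (fnLin 𝒯 y') + inner ℝ (astarLin 𝒯 y) (astarLin 𝒯 y')
    + inner ℝ (initLin 𝒯 y) (initLin 𝒯 y')
  conj_inner_symm x y := by
    simp only [conj_trivial]
    rw [real_inner_comm, real_inner_comm (astarLin 𝒯 x), real_inner_comm (initLin 𝒯 x)]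
  re_inner_nonneg x := by
    simp only [RCLike.re_to_real, real_inner_self_eq_norm_sq]
    positivity
  add_left x y z := by
    simp only [map_add, inner_add_left]
    ring
  smul_left x y r := by
    simp only [map_smul, real_inner_smul_left, conj_trivial]
    ring
  definite x h := by
    simp only [real_inner_self_eq_norm_sq] at h
    have h1 : ‖fnLin 𝒯 x‖ = 0 := by
      nlinarith [sq_nonneg ‖fnLin 𝒯 x‖, sq_nonneg ‖astarLin 𝒯 x‖, sq_nonneg ‖initLin 𝒯 x‖]
    have h2 : ‖initLin 𝒯 x‖ = 0 := by
      nlinarith [sq_nonneg ‖fnLin 𝒯 x‖, sq_nonneg ‖astarLin 𝒯 x‖, sq_nonneg ‖initLin 𝒯 x‖]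
    exact Prod.ext (Subtype.ext (norm_eq_zero.1 h1)) (norm_eq_zero.1 h2)

instance instNormedAddCommGroup : NormedAddCommGroup (TestSpace 𝒯) :=
  InnerProductSpace.Core.toNormedAddCommGroup (𝕜 := ℝ)

instance instInnerProductSpace : InnerProductSpace ℝ (TestSpace 𝒯) :=
  InnerProductSpace.ofCore (instCore 𝒯).toCore

lemma inner_def (y y' : TestSpace 𝒯) :
    inner ℝ y y' = inner ℝ (fnLin 𝒯 y) (fnLin 𝒯 y') + inner ℝ (astarLin 𝒯 y) (astarLin 𝒯 y')
      + inner ℝ (initLin 𝒯 y) (initLin 𝒯 y') := rfl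

lemma norm_sq_eq (y : TestSpace 𝒯) :
    ‖y‖ ^ 2 = ‖fnLin 𝒯 y‖ ^ 2 + ‖astarLin 𝒯 y‖ ^ 2 + ‖initLin 𝒯 y‖ ^ 2 := by
  simp only [← real_inner_self_eq_norm_sq, inner_def]

/-- `(w, ξ) ↦ w` as a bounded operator. -/
def fnL : TestSpace 𝒯 →L[ℝ] L2Pair (cylinder T Ω) :=
  (fnLin 𝒯).mkContinuous 1 fun y => by
    rw [one_mul]
    refine abs_le_of_sq_le_sq' ?_ (norm_nonneg y) |>.2
    rw [norm_sq_eq]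
    nlinarith [sq_nonneg ‖astarLin 𝒯 y‖, sq_nonneg ‖initLin 𝒯 y‖]

/-- `(w, ξ) ↦ A^*_h w` as a bounded operator. -/
def astarL : TestSpace 𝒯 →L[ℝ] L2Pair (cylinder T Ω) :=
  (astarLin 𝒯).mkContinuous 1 fun y => by
    rw [one_mul]
    refine abs_le_of_sq_le_sq' ?_ (norm_nonneg y) |>.2
    rw [norm_sq_eq]
    nlinarith [sq_nonneg ‖fnLin 𝒯 y‖, sq_nonneg ‖initLin 𝒯 y‖]

/-- `(w, ξ) ↦ ξ` as a bounded operator. -/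
def initL : TestSpace 𝒯 →L[ℝ] L2 Ω ℝ :=
  (initLin 𝒯).mkContinuous 1 fun y => by
    rw [one_mul]
    refine abs_le_of_sq_le_sq' ?_ (norm_nonneg y) |>.2
    rw [norm_sq_eq]
    nlinarith [sq_nonneg ‖fnLin 𝒯 y‖, sq_nonneg ‖astarLin 𝒯 y‖]

instance instCompleteSpace : CompleteSpace (TestSpace 𝒯) := by
  refine Metric.complete_of_cauchySeq_tendsto fun u hu => ?_
  obtain ⟨w, hw⟩ := cauchySeq_tendsto_of_complete
    (u := fun n => fnL 𝒯 (u n)) (hu.map (fnL 𝒯).uniformContinuous)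
  obtain ⟨z, hz⟩ := cauchySeq_tendsto_of_complete
    (u := fun n => astarL 𝒯 (u n)) (hu.map (astarL 𝒯).uniformContinuous)
  obtain ⟨ξ, hξ⟩ := cauchySeq_tendsto_of_complete
    (u := fun n => initL 𝒯 (u n)) (hu.map (initL 𝒯).uniformContinuous)
  have hrel : IsBrokenAstar 𝒯 w z := IsBrokenAstar.of_tendsto 𝒯
    (fun n => isBrokenAstar_brokenAstar 𝒯 (u n).1.2) hw hz
  let y : TestSpace 𝒯 := (⟨w, hrel.inGraphSpace⟩, ξ)
  have hy : astarLin 𝒯 y = z := hrel.eq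
  refine ⟨y, tendsto_iff_norm_sub_tendsto_zero.2 ?_⟩
  have e : ∀ n, ‖u n - y‖ = Real.sqrt (‖fnL 𝒯 (u n) - w‖ ^ 2 + ‖astarL 𝒯 (u n) - z‖ ^ 2
      + ‖initL 𝒯 (u n) - ξ‖ ^ 2) := fun n => by
    rw [← Real.sqrt_sq (norm_nonneg (u n - y)), norm_sq_eq, map_sub, map_sub, map_sub, hy]
    rfl
  simp only [e]
  have h1 := tendsto_iff_norm_sub_tendsto_zero.1 hw
  have h2 := tendsto_iff_norm_sub_tendsto_zero.1 hz
  have h3 := tendsto_iff_norm_sub_tendsto_zero.1 hξ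
  have := (((h1.pow 2).add (h2.pow 2)).add (h3.pow 2)).sqrt
  simpa using this

end TestSpace

/-! ### Traces, the form `b`, the trial-to-test operator, and the extension operator -/

/-- The trace `γ_A v ∈ Y^*`, that is
`(w, ξ) ↦ ⟨A v, w⟩ - ⟨v, A^*_h w⟩ + ⟨γ₀ v, ξ⟩`. -/
def traceA (v : L2Pair (cylinder T Ω)) : StrongDual ℝ (TestSpace 𝒯) :=
  (innerSL ℝ (opA v)).comp (TestSpace.fnL 𝒯) - (innerSL ℝ v).comp (TestSpace.astarL 𝒯)
    + (innerSL ℝ (initialTrace v)).comp (TestSpace.initL 𝒯)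

/-- The trace space `Γ(∂𝒯) = γ_A U₀ ⊆ Y^*`. -/
def traceSpace : Set (StrongDual ℝ (TestSpace 𝒯)) := traceA 𝒯 '' spaceU0 (cylinder T Ω)

/-- The functional `b(v, t; ·) ∈ Y^*`, with `b(v, t; w, ξ) = ⟨v, A^*_h w⟩ + ⟨t, (w, ξ)⟩`. -/
def formB (v : L2Pair (cylinder T Ω)) (t : StrongDual ℝ (TestSpace 𝒯)) :
    StrongDual ℝ (TestSpace 𝒯) :=
  (innerSL ℝ v).comp (TestSpace.astarL 𝒯) + t

/-- The trial-to-test operator: the Riesz representative of `b(v, t; ·)` in `Y`. -/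
def trialToTest (v : L2Pair (cylinder T Ω)) (t : StrongDual ℝ (TestSpace 𝒯)) : TestSpace 𝒯 :=
  (InnerProductSpace.toDual ℝ (TestSpace 𝒯)).symm (formB 𝒯 v t)

/-- The first component `T₁` of the trial-to-test operator. -/
def trialToTest₁ (v : L2Pair (cylinder T Ω)) (t : StrongDual ℝ (TestSpace 𝒯)) :
    L2Pair (cylinder T Ω) :=
  (trialToTest 𝒯 v t).1

/-- The extension operator `E(v, t) = v - A^*_h T₁(v, t)`. -/
def extension (v : L2Pair (cylinder T Ω)) (t : StrongDual ℝ (TestSpace 𝒯)) :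
    L2Pair (cylinder T Ω) :=
  v - brokenAstar 𝒯 (trialToTest₁ 𝒯 v t)

end TestSpace

end HeatDPG

end

/-! Write `t = γ_A q` with `q ∈ U₀`, `y = T(v, t) = (T₁, T₂)` and `E = v - A_h^* T₁`. The Riesz
equation for `y`, tested with `(0, ξ)`, says `T₂ = γ₀ q`. Tested with `(w, 0)`, it says `⟨E - q,
A_h^* w⟩ = ⟨T₁ - A q, w⟩` for every broken `w`: the difference `e = E - q` lies in the domain of the
Hilbert space adjoint of `A_h^*`, with value `f = T₁ - A q` (`IsAdjointPair`,
`isAdjointPair_extension_sub`). Everything follows from this one relation.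

Restrictions to `Q` of smooth functions on the whole time-space are admissible broken functions,
whatever their values on `∂Q`. Testing with them gives `e ∈ U₀` and `A e = f`, hence `E = q + e ∈
U₀` and `A E = T₁` (`IsAdjointPair.isGraphU0`, `isGraphU0_extension`). Since these tests need not
vanish at `t = 0`, they also force `γ₀ e = 0` (`IsAdjointPair.hasInitialTrace_zero`). This is the
analytic core. The extensions by zero of `e` and `f` satisfy the weak equations on all of `ℝ × ℝ^d`.
Mollifying preserves these equations, and the energy estimate `integral_slice_sq_le` makes the
mollified functions uniformly Cauchy in time with values in `L²(Ω)`. The limit is a continuous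
representative that vanishes for `t < 0`, hence at `t = 0` (`exists_continuous_representative`).

Now `γ₀ E = γ₀ q`, and the adjoint relation is exactly the statement that `γ_A E` and `γ_A q` agree.
The formula for the dual norm is the isometry of the Riesz map. The last three claims are
Pythagorean arguments in the graph inner product: the adjoint relation is tested with `w = T₁`
itself, using `A_h^* T₁(v, t) = v - E(v, t)` and the linearity of `E`. -/

open scoped ENNReal

noncomputable section

namespace HeatDPG

set_option linter.unusedSectionVars false

/-! ### Mollification in `L²` -/

section Mollify

variable {G : Type*} [NormedAddCommGroup G] [NormedSpace ℝ G] [FiniteDimensional ℝ G]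
  [MeasurableSpace G] [BorelSpace G] {μ : Measure G} [μ.IsAddHaarMeasure]
  {F : Type*} [NormedAddCommGroup F]

/-- Translations are continuous on `L²`. -/
lemma tendsto_lintegral_translate_sub {u : G → F} (hu : MemLp u 2 μ) :
    Tendsto (fun h => ∫⁻ x, ‖u (x - h) - u x‖ₑ ^ 2 ∂μ) (𝓝 0) (𝓝 0) := by
  -- Composition with measure preserving maps is continuous on `L²` when the maps vary continuously
  -- in the compact-open topology; translations do so, by currying subtraction.
  have hmp : ∀ h : G, MeasurePreserving (fun x => x - h) μ μ :=
    fun h => measurePreserving_sub_right μ h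
  let g : G → C(G, G) := fun h => ⟨fun x => x - h, by fun_prop⟩
  have hg : Continuous g := by
    let c : C(G × G, G) := ⟨fun p => p.2 - p.1, by fun_prop⟩
    exact c.curry.continuous
  have hc : Continuous fun h => Lp.compMeasurePreserving (g h) (hmp h) (hu.toLp u) :=
    Continuous.compMeasurePreservingLp continuous_const hg hmp (by simp)
  have h0 : Lp.compMeasurePreserving (g 0) (hmp 0) (hu.toLp u) = hu.toLp u := by
    rw [Lp.toLp_compMeasurePreserving]
    congr 1
    ext x
    simp [g]
  have h1 := (hc.tendsto 0)
  rw [h0] at h1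
  have h2 := tendsto_iff_edist_tendsto_0.1 h1
  have h3 := ((ENNReal.continuous_pow 2).tendsto 0).comp h2
  simp only [ne_eq, OfNat.ofNat_ne_zero, not_false_eq_true, zero_pow] at h3
  refine h3.congr fun h => ?_
  rw [Function.comp_apply, Lp.toLp_compMeasurePreserving, Lp.edist_toLp_toLp,
    eLpNorm_eq_lintegral_rpow_enorm_toReal (by simp) (by simp), ← ENNReal.rpow_natCast,
    ← ENNReal.rpow_mul]
  simp [g]

variable [NormedSpace ℝ F] [CompleteSpace F]

/-- The convolution `∫ ρ(x - y) u(y) dy`. -/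
def mollify (μ : Measure G) (ρ : G → ℝ) (u : G → F) (x : G) : F := ∫ y, ρ (x - y) • u y ∂μ

lemma integrable_mollify {u : G → F} (hu : LocallyIntegrable u μ) {ρ : G → ℝ}
    (hρ : Continuous ρ) (hc : HasCompactSupport ρ) (x : G) :
    Integrable (fun y => ρ (x - y) • u y) μ := by
  have h1 : HasCompactSupport fun y => ρ (x - y) := hc.comp_homeomorph (Homeomorph.subLeft x)
  exact hu.integrable_smul_left_of_hasCompactSupport (by fun_prop) h1

/-- Jensen's inequality for the square, obtained from `‖·‖_{L¹} ≤ ‖·‖_{L²}` on a probability space.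
-/
lemma enorm_integral_sq_le {α : Type*} [MeasurableSpace α] {ν : Measure α}
    [IsProbabilityMeasure ν] {u : α → F} (hu : AEStronglyMeasurable u ν) :
    ‖∫ x, u x ∂ν‖ₑ ^ 2 ≤ ∫⁻ x, ‖u x‖ₑ ^ 2 ∂ν := by
  have h1 : ‖∫ x, u x ∂ν‖ₑ ≤ eLpNorm u 2 ν := by
    refine (enorm_integral_le_lintegral_enorm u).trans ?_
    rw [← eLpNorm_one_eq_lintegral_enorm]
    exact eLpNorm_le_eLpNorm_of_exponent_le (by norm_num) hu
  refine (pow_le_pow_left' h1 2).trans_eq ?_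
  rw [eLpNorm_eq_lintegral_rpow_enorm_toReal (by simp) (by simp), ← ENNReal.rpow_natCast,
    ← ENNReal.rpow_mul]
  simp

/-- The mollification error at `x` is the average of `u (x - h) - u x` over `h` with respect to the
probability measure of density `ρ`. Jensen and Tonelli then bound it by the worst translation error
in the support of `ρ`. Strong measurability makes the integrand jointly measurable in `(x, h)`. -/
lemma lintegral_mollify_sub_le {u : G → F} (hm : StronglyMeasurable u) (hu : MemLp u 2 μ)
    (φ : ContDiffBump (0 : G)) {ε : ℝ≥0∞}
    (hε : ∀ h ∈ Metric.ball (0 : G) φ.rOut, ∫⁻ x, ‖u (x - h) - u x‖ₑ ^ 2 ∂μ ≤ ε) :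
    ∫⁻ x, ‖mollify μ (φ.normed μ) u x - u x‖ₑ ^ 2 ∂μ ≤ ε := by
  set ρ := φ.normed μ with hρ
  have hρc : Continuous ρ := φ.continuous_normed
  have hρs : HasCompactSupport ρ := φ.hasCompactSupport_normed
  have hρ0 : ∀ x, 0 ≤ ρ x := fun x => φ.nonneg_normed x
  let ν : Measure G := μ.withDensity fun h => ENNReal.ofReal (ρ h)
  have hρm : Measurable fun h => ENNReal.ofReal (ρ h) := hρc.measurable.ennreal_ofReal
  have hν : IsProbabilityMeasure ν := ⟨by
    rw [withDensity_apply _ MeasurableSet.univ, Measure.restrict_univ,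
      ← ofReal_integral_eq_lintegral_ofReal φ.integrable_normed (Eventually.of_forall hρ0),
      φ.integral_normed]
    simp⟩
  have hloc : LocallyIntegrable u μ := hu.locallyIntegrable (by norm_num)
  have e1 : ∀ x, mollify μ ρ u x - u x = ∫ h, (u (x - h) - u x) ∂ν := by
    intro x
    have i1 : Integrable (fun h => ρ h • u (x - h)) μ := by
      have := (integrable_mollify hloc hρc hρs x).comp_sub_left x
      simpa using this
    have i2 : Integrable (fun h => ρ h • u x) μ := φ.integrable_normed.smul_const _
    have e : ∫ h, (u (x - h) - u x) ∂ν = ∫ h, ρ h • (u (x - h) - u x) ∂μ := by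
      rw [integral_withDensity_eq_integral_toReal_smul hρm (by simp)]
      refine integral_congr_ae (Eventually.of_forall fun h => ?_)
      simp [ENNReal.toReal_ofReal (hρ0 h)]
    rw [e]
    simp only [smul_sub]
    rw [integral_sub i1 i2, integral_smul_const, hρ, φ.integral_normed, one_smul, ← hρ, mollify,
      ← integral_sub_left_eq_self _ μ x]
    simp
  have hsm : StronglyMeasurable fun p : G × G => u (p.1 - p.2) - u p.1 :=
    (hm.comp_measurable (measurable_fst.sub measurable_snd)).sub (hm.comp_measurable measurable_fst)
  calc ∫⁻ x, ‖mollify μ ρ u x - u x‖ₑ ^ 2 ∂μ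
      ≤ ∫⁻ x, ∫⁻ h, ‖u (x - h) - u x‖ₑ ^ 2 ∂ν ∂μ := by
        refine lintegral_mono fun x => ?_
        rw [e1]
        exact enorm_integral_sq_le (hsm.comp_measurable measurable_prodMk_left).aestronglyMeasurable
    _ = ∫⁻ h, ∫⁻ x, ‖u (x - h) - u x‖ₑ ^ 2 ∂μ ∂ν :=
        lintegral_lintegral_swap (hsm.enorm.pow_const 2).aemeasurable
    _ ≤ ∫⁻ _h, ε ∂ν := by
        refine lintegral_mono_ae ?_
        have hm2 : Measurable fun h => ∫⁻ x, ‖u (x - h) - u x‖ₑ ^ 2 ∂μ :=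
          Measurable.lintegral_prod_left' (hsm.enorm.pow_const 2)
        -- Only those `h` count at which the density is nonzero, and these lie in the ball of radius
        -- `φ.rOut`.
        rw [ae_withDensity_iff hρm]
        refine Eventually.of_forall fun h hh => hε h ?_
        by_contra hn
        refine hh ?_
        have : ρ h = 0 := by
          rw [← Function.notMem_support, hρ, φ.support_normed_eq]
          exact hn
        simp [this]
    _ = ε := by simp

/-- Mollification converges in `L²`. -/
lemma tendsto_lintegral_mollify_sub {u : G → F} (hm : StronglyMeasurable u) (hu : MemLp u 2 μ)
    {φ : ℕ → ContDiffBump (0 : G)} (hφ : Tendsto (fun n => (φ n).rOut) atTop (𝓝 0)) :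
    Tendsto (fun n => ∫⁻ x, ‖mollify μ ((φ n).normed μ) u x - u x‖ₑ ^ 2 ∂μ) atTop (𝓝 0) := by
  rw [ENNReal.tendsto_nhds_zero]
  intro ε hε
  have h := (ENNReal.tendsto_nhds_zero.1 (tendsto_lintegral_translate_sub hu)) ε hε
  obtain ⟨δ, hδ, hb⟩ := Metric.eventually_nhds_iff_ball.1 h
  filter_upwards [hφ.eventually (gt_mem_nhds hδ)] with n hn
  exact lintegral_mollify_sub_le hm hu _ fun k hk => hb k (Metric.ball_subset_ball hn.le hk)

/-- Makes the difference of two mollifications a single mollification with kernel `ρ - σ`, to which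
the energy estimate applies directly. -/
lemma mollify_sub {u : G → F} (hu : LocallyIntegrable u μ) {ρ σ : G → ℝ}
    (hρ : Continuous ρ) (hρc : HasCompactSupport ρ) (hσ : Continuous σ)
    (hσc : HasCompactSupport σ) (x : G) :
    mollify μ (fun y => ρ y - σ y) u x = mollify μ ρ u x - mollify μ σ u x := by
  simp only [mollify, sub_smul]
  exact integral_sub (integrable_mollify hu hρ hρc x) (integrable_mollify hu hσ hσc x)

lemma mollify_eq_convolution (ρ : G → ℝ) (u : G → F) :
    mollify μ ρ u = convolution u ρ (ContinuousLinearMap.lsmul ℝ ℝ).flip μ := rfl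

lemma contDiff_mollify {u : G → F} (hu : LocallyIntegrable u μ) {ρ : G → ℝ}
    (hρ : ContDiff ℝ ∞ ρ) (hc : HasCompactSupport ρ) : ContDiff ℝ ∞ (mollify μ ρ u) := by
  rw [mollify_eq_convolution]
  exact hc.contDiff_convolution_right _ hu hρ

lemma fderiv_mollify {u : G → F} (hu : LocallyIntegrable u μ) {ρ : G → ℝ}
    (hρ : ContDiff ℝ ∞ ρ) (hc : HasCompactSupport ρ) (x e : G) :
    fderiv ℝ (mollify μ ρ u) x e = ∫ y, fderiv ℝ ρ (x - y) e • u y ∂μ := by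
  rw [mollify_eq_convolution,
    (hc.hasFDerivAt_convolution_right (ContinuousLinearMap.lsmul ℝ ℝ).flip hu
      (hρ.of_le (by simp)) x).fderiv, convolution_precompR_apply _ hu (hc.fderiv ℝ)
      (hρ.continuous_fderiv (by simp))]
  rfl

lemma hasCompactSupport_mollify {u : G → F} (hu : HasCompactSupport u) {ρ : G → ℝ}
    (hc : HasCompactSupport ρ) : HasCompactSupport (mollify μ ρ u) := by
  rw [mollify_eq_convolution]
  exact hu.convolution _ hc

end Mollify

instance (d : ℕ) : (volume : Measure (TimeSpace d)).IsAddHaarMeasure :=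
  Measure.prod.instIsAddHaarMeasure _ _

/-! ### Classical derivatives are weak derivatives -/

lemma integral_mul_fderiv_eq_neg {H : Type*} [NormedAddCommGroup H] [NormedSpace ℝ H]
    [FiniteDimensional ℝ H] [MeasurableSpace H] [BorelSpace H] (μ : Measure H)
    [μ.IsAddHaarMeasure] {φ η : H → ℝ} (hφ : ContDiff ℝ ∞ φ) (hη : ContDiff ℝ ∞ η)
    (hc : HasCompactSupport η) (e : H) :
    ∫ p, φ p * fderiv ℝ η p e ∂μ = - ∫ p, fderiv ℝ φ p e * η p ∂μ := by
  have h1 : Continuous fun p => fderiv ℝ φ p e :=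
    (hφ.continuous_fderiv (by simp)).clm_apply continuous_const
  have h2 : Continuous fun p => fderiv ℝ η p e :=
    (hη.continuous_fderiv (by simp)).clm_apply continuous_const
  have h3 : HasCompactSupport fun p => fderiv ℝ η p e := hc.fderiv_apply ℝ e
  refine integral_mul_fderiv_eq_neg_fderiv_mul_of_integrable ?_ ?_ ?_
    (fun x _ => hφ.differentiable (by simp) x) (fun x _ => hη.differentiable (by simp) x)
  · exact (h1.mul hη.continuous).integrable_of_hasCompactSupport hc.mul_left
  · exact (hφ.continuous.mul h2).integrable_of_hasCompactSupport h3.mul_left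
  · exact (hφ.continuous.mul hη.continuous).integrable_of_hasCompactSupport hc.mul_left

lemma fderiv_coord {H : Type*} [NormedAddCommGroup H] [NormedSpace ℝ H] {d : ℕ}
    {χ : H → Space d} (hχ : ContDiff ℝ ∞ χ) (i : Fin d) (p e : H) :
    fderiv ℝ χ p e i = fderiv ℝ (fun q => χ q i) p e := by
  have h := ((EuclideanSpace.proj i : Space d →L[ℝ] ℝ).hasFDerivAt).comp p
    (hχ.differentiable (by simp) p).hasFDerivAt
  have h' : fderiv ℝ (fun q => χ q i) p = _ := h.fderiv
  rw [h']
  rfl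

lemma contDiff_coord {H : Type*} [NormedAddCommGroup H] [NormedSpace ℝ H] {d : ℕ}
    {χ : H → Space d} (hχ : ContDiff ℝ ∞ χ) (i : Fin d) : ContDiff ℝ ∞ fun q => χ q i :=
  (EuclideanSpace.proj i : Space d →L[ℝ] ℝ).contDiff.comp hχ

lemma hasCompactSupport_coord {H : Type*} [TopologicalSpace H] {d : ℕ}
    {χ : H → Space d} (hχ : HasCompactSupport χ) (i : Fin d) : HasCompactSupport fun q => χ q i :=
  hχ.comp_left (g := fun y : Space d => y i) rfl

variable {d : ℕ}

lemma inner_gradX (φ : TimeSpace d → ℝ) (y : Space d) (p : TimeSpace d) :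
    inner ℝ y (gradX φ p) = ∑ i, y i * fderiv ℝ φ p (0, EuclideanSpace.single i 1) := by
  simp [gradX, PiLp.inner_apply, mul_comm]

lemma integrable_mul_of_hasCompactSupport {H : Type*} [TopologicalSpace H] [MeasurableSpace H]
    [OpensMeasurableSpace H] {μ : Measure H} [IsFiniteMeasureOnCompacts μ] {a b : H → ℝ}
    (ha : Continuous a) (hb : Continuous b) (hc : HasCompactSupport b) :
    Integrable (fun p => a p * b p) μ :=
  (ha.mul hb).integrable_of_hasCompactSupport hc.mul_left

lemma continuous_fderiv_apply {H F : Type*} [NormedAddCommGroup H] [NormedSpace ℝ H]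
    [NormedAddCommGroup F] [NormedSpace ℝ F] {φ : H → F} (hφ : ContDiff ℝ ∞ φ) (e : H) :
    Continuous fun p => fderiv ℝ φ p e :=
  (hφ.continuous_fderiv (by simp)).clm_apply continuous_const

/-- Gauss' formula on the whole space. -/
lemma integral_mul_divX {φ : TimeSpace d → ℝ} {η : TimeSpace d → Space d} (hφ : ContDiff ℝ ∞ φ)
    (hη : ContDiff ℝ ∞ η) (hc : HasCompactSupport η) :
    ∫ p, φ p * divX η p = - ∫ p, inner ℝ (gradX φ p) (η p) := by
  have e1 : ∀ p, inner ℝ (gradX φ p) (η p)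
      = ∑ i, fderiv ℝ φ p (0, EuclideanSpace.single i 1) * η p i := fun p => by
    rw [real_inner_comm, inner_gradX]
    simp only [mul_comm]
  have e2 : ∀ p, φ p * divX η p
      = ∑ i, φ p * fderiv ℝ (fun q => η q i) p (0, EuclideanSpace.single i 1) := fun p => by
    rw [divX, Finset.mul_sum]
    simp only [fderiv_coord hη]
  simp only [e1, e2]
  rw [integral_finsetSum _ fun i _ => integrable_mul_of_hasCompactSupport hφ.continuous
      (continuous_fderiv_apply (contDiff_coord hη i) _)
      ((hasCompactSupport_coord hc i).fderiv_apply ℝ _),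
    integral_finsetSum _ fun i _ => integrable_mul_of_hasCompactSupport
      (continuous_fderiv_apply hφ _) (contDiff_coord hη i).continuous
      (hasCompactSupport_coord hc i), ← Finset.sum_neg_distrib]
  exact Finset.sum_congr rfl fun i _ => integral_mul_fderiv_eq_neg volume hφ (contDiff_coord hη i)
    (hasCompactSupport_coord hc i) _

/-- Gauss' formula on the whole space. -/
lemma integral_inner_gradX {η : TimeSpace d → ℝ} {χ : TimeSpace d → Space d} (hχ : ContDiff ℝ ∞ χ)
    (hη : ContDiff ℝ ∞ η) (hc : HasCompactSupport η) :
    ∫ p, inner ℝ (χ p) (gradX η p) = - ∫ p, divX χ p * η p := by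
  simp only [inner_gradX, divX, Finset.sum_mul, fderiv_coord hχ]
  rw [integral_finsetSum _ fun i _ => integrable_mul_of_hasCompactSupport
      (contDiff_coord hχ i).continuous (continuous_fderiv_apply hη _) (hc.fderiv_apply ℝ _),
    integral_finsetSum _ fun i _ => integrable_mul_of_hasCompactSupport
      (continuous_fderiv_apply (contDiff_coord hχ i) _) hη.continuous hc, ← Finset.sum_neg_distrib]
  exact Finset.sum_congr rfl fun i _ => integral_mul_fderiv_eq_neg volume (contDiff_coord hχ i) hη
    hc _

/-- The test function and its divergence vanish off `K`, so both integrals may be taken over the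
whole space; no regularity of `K` enters. -/
lemma hasWeakGradX_of_contDiff (K : Set (TimeSpace d)) {φ : TimeSpace d → ℝ}
    (hφ : ContDiff ℝ ∞ φ) : HasWeakGradX K φ (gradX φ) := by
  intro η h1 h2 h3
  have h4 : tsupport (divX η) ⊆ K := by
    refine (closure_minimal (fun p hp => ?_) (isClosed_tsupport η)).trans h3
    by_contra hn
    refine hp ?_
    have : fderiv ℝ η p = 0 := image_eq_zero_of_notMem_tsupport
      fun h => hn (tsupport_fderiv_subset ℝ h)
    simp [divX, this]
  rw [setIntegral_eq_integral_of_forall_compl_eq_zero fun p hp => by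
      rw [image_eq_zero_of_notMem_tsupport fun h => hp (h4 h), mul_zero],
    setIntegral_eq_integral_of_forall_compl_eq_zero fun p hp => by
      rw [image_eq_zero_of_notMem_tsupport fun h => hp (h3 h), inner_zero_right]]
  exact integral_mul_divX hφ h1 h2

lemma hasWeakDiv_of_contDiff (K : Set (TimeSpace d)) {φ : TimeSpace d → ℝ}
    {χ : TimeSpace d → Space d} (hφ : ContDiff ℝ ∞ φ) (hχ : ContDiff ℝ ∞ χ) :
    HasWeakDiv K φ χ (fun p => timeDeriv φ p + divX χ p) := by
  intro η h1 h2 h3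
  have h4 : ∀ p ∉ K, fderiv ℝ η p = 0 := fun p hp =>
    image_eq_zero_of_notMem_tsupport fun h => hp (h3 (tsupport_fderiv_subset ℝ h))
  rw [setIntegral_eq_integral_of_forall_compl_eq_zero fun p hp => by
      simp [timeDeriv, inner_gradX, h4 p hp],
    setIntegral_eq_integral_of_forall_compl_eq_zero fun p hp => by
      rw [image_eq_zero_of_notMem_tsupport fun h => hp (h3 h), mul_zero]]
  have i1 : Integrable fun p => φ p * timeDeriv η p := integrable_mul_of_hasCompactSupport
    hφ.continuous (continuous_timeDeriv h1) (hasCompactSupport_timeDeriv h2)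
  have i2 : Integrable fun p => inner ℝ (χ p) (gradX η p) :=
    (hχ.continuous.inner (continuous_gradX h1)).integrable_of_hasCompactSupport
      ((hasCompactSupport_gradX h2).mono fun p hp h => hp (by simp [h]))
  have i3 : Integrable fun p => timeDeriv φ p * η p := integrable_mul_of_hasCompactSupport
    (continuous_timeDeriv hφ) h1.continuous h2
  have i4 : Integrable fun p => divX χ p * η p := integrable_mul_of_hasCompactSupport
    (continuous_divX hχ) h1.continuous h2
  rw [integral_add i1 i2, integral_inner_gradX hχ h1 h2]
  simp only [add_mul]
  rw [integral_add i3 i4, neg_add]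
  congr 1
  exact integral_mul_fderiv_eq_neg volume hφ h1 h2 _

/-! ### Mollification of weak derivatives -/

section

variable {V f : TimeSpace d → ℝ} {τ g : TimeSpace d → Space d} {ρ : TimeSpace d → ℝ}

lemma fderiv_comp_const_sub_apply {H : Type*} [NormedAddCommGroup H] [NormedSpace ℝ H] {ρ : H → ℝ}
    (hρ : ContDiff ℝ ∞ ρ) (x y e : H) : fderiv ℝ (fun z => ρ (x - z)) y e = - fderiv ℝ ρ (x - y) e := by
  have h := ((hρ.differentiable (by simp) (x - y)).hasFDerivAt).comp y
    ((hasFDerivAt_id y).const_sub x)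
  have h' : fderiv ℝ (fun z => ρ (x - z)) y = _ := h.fderiv
  rw [h']
  simp

lemma integral_coord {α : Type*} [MeasurableSpace α] {μ : Measure α} {u : α → Space d}
    (hu : Integrable u μ) (i : Fin d) : (∫ x, u x ∂μ) i = ∫ x, u x i ∂μ :=
  ((EuclideanSpace.proj i : Space d →L[ℝ] ℝ).integral_comp_comm hu).symm

/-- Test the weak gradient with `y ↦ ρ (x - y) e_i`; the sign from differentiating in `y` cancels
the sign from the integration by parts. -/
lemma gradX_mollify (hV : LocallyIntegrable V) (hg : LocallyIntegrable g)
    (hρ : ContDiff ℝ ∞ ρ) (hc : HasCompactSupport ρ) (h : HasWeakGradX univ V g)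
    (x : TimeSpace d) : gradX (mollify volume ρ V) x = mollify volume ρ g x := by
  ext i
  have hη : ContDiff ℝ ∞ fun y => ρ (x - y) := hρ.comp (contDiff_const.sub contDiff_id)
  have hηc : HasCompactSupport fun y => ρ (x - y) := hc.comp_homeomorph (Homeomorph.subLeft x)
  have h1 := h (fun y => ρ (x - y) • EuclideanSpace.single i (1 : ℝ)) (hη.smul contDiff_const)
    (hηc.smul_right (f' := fun _ => EuclideanSpace.single i (1 : ℝ))) (subset_univ _)
  simp only [Measure.restrict_univ] at h1
  have e1 : ∀ y, divX (fun y => ρ (x - y) • (EuclideanSpace.single i (1 : ℝ) : Space d)) y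
      = - fderiv ℝ ρ (x - y) (0, EuclideanSpace.single i 1) := fun y => by
    have hd : ∀ e, fderiv ℝ (fun y => ρ (x - y) • (EuclideanSpace.single i (1 : ℝ) : Space d)) y e
        = (- fderiv ℝ ρ (x - y) e) • EuclideanSpace.single i (1 : ℝ) := fun e => by
      rw [fderiv_smul_const (hη.differentiable (by simp) y), ContinuousLinearMap.smulRight_apply,
        fderiv_comp_const_sub_apply hρ]
    rw [divX, Finset.sum_eq_single i]
    · rw [hd]
      simp
    · intro j _ hj
      rw [hd]
      simp [hj.symm]
    · simp
  rw [mollify, integral_coord (integrable_mollify hg hρ.continuous hc x)]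
  change fderiv ℝ (mollify volume ρ V) x _ = _
  rw [fderiv_mollify hV hρ hc]
  simp only [e1, mul_neg, integral_neg, neg_inj] at h1
  simp only [smul_eq_mul, mul_comm _ (V _), h1]
  refine integral_congr_ae (Eventually.of_forall fun y => ?_)
  simp [inner_smul_right, EuclideanSpace.inner_single_right]

/-- Test the weak divergence with `y ↦ ρ (x - y)`. Only the sum of the two terms is controlled: `∂_t
V` and `div_x τ` need not be functions separately. -/
lemma timeDeriv_add_divX_mollify (hV : LocallyIntegrable V) (hτ : LocallyIntegrable τ)
    (hρ : ContDiff ℝ ∞ ρ) (hc : HasCompactSupport ρ) (h : HasWeakDiv univ V τ f)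
    (x : TimeSpace d) :
    timeDeriv (mollify volume ρ V) x + divX (mollify volume ρ τ) x = mollify volume ρ f x := by
  have hη : ContDiff ℝ ∞ fun y => ρ (x - y) := hρ.comp (contDiff_const.sub contDiff_id)
  have hηc : HasCompactSupport fun y => ρ (x - y) := hc.comp_homeomorph (Homeomorph.subLeft x)
  have h1 := h (fun y => ρ (x - y)) hη hηc (subset_univ _)
  simp only [Measure.restrict_univ, timeDeriv, inner_gradX, fderiv_comp_const_sub_apply hρ] at h1
  have hi : ∀ e : TimeSpace d, ∀ i, Integrable fun y => fderiv ℝ ρ (x - y) e * τ y i := by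
    intro e i
    have := integrable_mollify hτ (continuous_fderiv_apply hρ e) (hc.fderiv_apply ℝ e) x
    exact ((EuclideanSpace.proj i : Space d →L[ℝ] ℝ).integrable_comp this)
  have hi' : ∀ e : TimeSpace d, Integrable fun y => fderiv ℝ ρ (x - y) e * V y := fun e =>
    integrable_mollify hV (continuous_fderiv_apply hρ e) (hc.fderiv_apply ℝ e) x
  have e1 : divX (mollify volume ρ τ) x
      = ∫ y, ∑ i, fderiv ℝ ρ (x - y) (0, EuclideanSpace.single i 1) * τ y i := by
    rw [integral_finsetSum _ fun i _ => hi _ i, divX]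
    refine Finset.sum_congr rfl fun i _ => ?_
    rw [fderiv_mollify hτ hρ hc, integral_coord (integrable_mollify hτ
      (continuous_fderiv_apply hρ _) (hc.fderiv_apply ℝ _) x)]
    rfl
  rw [timeDeriv, e1, fderiv_mollify hV hρ hc]
  simp only [smul_eq_mul]
  rw [← integral_add (hi' _) (integrable_finsetSum _ fun i _ => hi _ i), mollify, ← neg_inj]
  simp only [smul_eq_mul, mul_comm (ρ _), ← h1]
  rw [← integral_neg]
  refine integral_congr_ae (Eventually.of_forall fun y => ?_)
  simp only [mul_neg, Finset.sum_neg_distrib, neg_add, mul_comm]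

end

/-! ### The energy estimate -/

lemma fderiv_slice_right {F : Type*} [NormedAddCommGroup F] [NormedSpace ℝ F]
    {v : TimeSpace d → F} (hv : ContDiff ℝ ∞ v) (t : ℝ) (x e : Space d) :
    fderiv ℝ (fun y => v (t, y)) x e = fderiv ℝ v (t, x) (0, e) := by
  have h := ((hv.differentiable (by simp) (t, x)).hasFDerivAt).comp x
    (hasFDerivAt_prodMk_right t x)
  have h' : fderiv ℝ (fun y => v (t, y)) x = _ := h.fderiv
  rw [h']
  simp

lemma deriv_slice_left {F : Type*} [NormedAddCommGroup F] [NormedSpace ℝ F]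
    {v : TimeSpace d → F} (hv : ContDiff ℝ ∞ v) (t : ℝ) (x : Space d) :
    deriv (fun s => v (s, x)) t = fderiv ℝ v (t, x) (1, 0) := by
  have h := ((hv.differentiable (by simp) (t, x)).hasFDerivAt).comp_hasDerivAt t
    (hasFDerivAt_prodMk_left t x).hasDerivAt
  have h' : deriv (fun s => v (s, x)) t = _ := h.deriv
  rw [h']
  simp

lemma hasCompactSupport_slice_right {F : Type*} [Zero F] {v : TimeSpace d → F}
    (hc : HasCompactSupport v) (t : ℝ) : HasCompactSupport fun y => v (t, y) :=
  HasCompactSupport.intro (hc.isCompact.image continuous_snd) fun _ hy =>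
    image_eq_zero_of_notMem_tsupport fun h => hy ⟨_, h, rfl⟩

lemma hasCompactSupport_slice_left {F : Type*} [Zero F] {v : TimeSpace d → F}
    (hc : HasCompactSupport v) (x : Space d) : HasCompactSupport fun s => v (s, x) :=
  HasCompactSupport.intro (hc.isCompact.image continuous_fst) fun _ hy =>
    image_eq_zero_of_notMem_tsupport fun h => hy ⟨_, h, rfl⟩

/-- Gauss' formula on a time slice. -/
lemma integral_slice_mul_divX {v : TimeSpace d → ℝ} {τ : TimeSpace d → Space d}
    (hv : ContDiff ℝ ∞ v) (hτ : ContDiff ℝ ∞ τ) (hc : HasCompactSupport τ) (t : ℝ) :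
    ∫ x, (v (t, x) * divX τ (t, x) + inner ℝ (gradX v (t, x)) (τ (t, x))) = 0 := by
  have hs : ContDiff ℝ ∞ fun x : Space d => ((t, x) : TimeSpace d) :=
    contDiff_const.prodMk contDiff_id
  have e : ∀ x, v (t, x) * divX τ (t, x) + inner ℝ (gradX v (t, x)) (τ (t, x))
      = ∑ i, (v (t, x) * fderiv ℝ (fun y => τ (t, y) i) x (EuclideanSpace.single i 1)
        + fderiv ℝ (fun y => v (t, y)) x (EuclideanSpace.single i 1) * τ (t, x) i) := fun x => by
    rw [real_inner_comm, inner_gradX, divX, Finset.mul_sum, ← Finset.sum_add_distrib]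
    refine Finset.sum_congr rfl fun i _ => ?_
    rw [fderiv_coord hτ, fderiv_slice_right (contDiff_coord hτ i), fderiv_slice_right hv]
    ring
  simp only [e]
  have hτi : ∀ i, ContDiff ℝ ∞ fun y => τ (t, y) i := fun i => (contDiff_coord hτ i).comp hs
  have hvs : ContDiff ℝ ∞ fun y => v (t, y) := hv.comp hs
  have hci : ∀ i, HasCompactSupport fun y => τ (t, y) i := fun i =>
    hasCompactSupport_slice_right (hasCompactSupport_coord hc i) t
  have i1 : ∀ i, Integrable fun x =>
      v (t, x) * fderiv ℝ (fun y => τ (t, y) i) x (EuclideanSpace.single i 1) := fun i =>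
    integrable_mul_of_hasCompactSupport hvs.continuous (continuous_fderiv_apply (hτi i) _)
      ((hci i).fderiv_apply ℝ _)
  have i2 : ∀ i, Integrable fun x =>
      fderiv ℝ (fun y => v (t, y)) x (EuclideanSpace.single i 1) * τ (t, x) i := fun i =>
    integrable_mul_of_hasCompactSupport (continuous_fderiv_apply hvs _) (hτi i).continuous (hci i)
  have i3 : ∀ i, Integrable fun x =>
      v (t, x) * fderiv ℝ (fun y => τ (t, y) i) x (EuclideanSpace.single i 1)
        + fderiv ℝ (fun y => v (t, y)) x (EuclideanSpace.single i 1) * τ (t, x) i := fun i =>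
    (i1 i).add (i2 i)
  rw [integral_finsetSum _ fun i _ => i3 i]
  refine Finset.sum_eq_zero fun i _ => ?_
  rw [integral_add (i1 i) (i2 i), integral_mul_fderiv_eq_neg volume hvs (hτi i) (hci i),
    neg_add_cancel]

/-- The energy estimate for smooth functions with compact support. -/
lemma integral_slice_sq_le {v : TimeSpace d → ℝ} {τ : TimeSpace d → Space d}
    (hv : ContDiff ℝ ∞ v) (hvc : HasCompactSupport v) (hτ : ContDiff ℝ ∞ τ)
    (hτc : HasCompactSupport τ) (t : ℝ) :
    ∫ x, v (t, x) ^ 2 ≤ ∫ p, (‖v p‖ ^ 2 + ‖τ p‖ ^ 2 + ‖gradX v p‖ ^ 2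
      + ‖timeDeriv v p + divX τ p‖ ^ 2) := by
  have ct := continuous_timeDeriv hv
  have cg := continuous_gradX hv
  have cd := continuous_divX hτ
  have cv := hv.continuous
  have cτ := hτ.continuous
  -- Here `h - c = v ∂_t v`. The term `c` is a spatial divergence and integrates to zero on each
  -- time slice, so the uncontrolled `div_x τ` survives only inside `∂_t v + div_x τ`.
  let c : TimeSpace d → ℝ := fun p => v p * divX τ p + inner ℝ (gradX v p) (τ p)
  let h : TimeSpace d → ℝ := fun p => v p * (timeDeriv v p + divX τ p) + inner ℝ (gradX v p) (τ p)
  have hic : Integrable c :=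
    (integrable_mul_of_hasCompactSupport cv cd (hasCompactSupport_divX hτc)).add <|
      (cg.inner cτ).integrable_of_hasCompactSupport (hτc.mono fun p hp h => hp (by simp [h]))
  have hih : Integrable h := by
    refine Continuous.integrable_of_hasCompactSupport
      ((cv.mul (ct.add cd)).add (cg.inner cτ)) ?_
    refine HasCompactSupport.add (hvc.mul_right) (hτc.mono fun p hp h => hp (by simp [h]))
  have hR : Integrable fun p => ‖v p‖ ^ 2 + ‖τ p‖ ^ 2 + ‖gradX v p‖ ^ 2
      + ‖timeDeriv v p + divX τ p‖ ^ 2 := by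
    refine Continuous.integrable_of_hasCompactSupport (by fun_prop) ?_
    refine ((HasCompactSupport.add ?_ ?_).add ?_).add ?_
    · exact hvc.mono fun p hp h => hp (by simp [h])
    · exact hτc.mono fun p hp h => hp (by simp [h])
    · exact (hasCompactSupport_gradX hvc).mono fun p hp h => hp (by simp [h])
    · exact ((hasCompactSupport_timeDeriv hvc).add (hasCompactSupport_divX hτc)).mono
        fun p hp h => hp (by simp only [Pi.add_apply] at h; simp [h])
  -- Integrating `∂_t (v²) = 2 v ∂_t v` from `-∞` leaves no boundary term, because `v` has compact
  -- support.
  have e1 : ∀ x, v (t, x) ^ 2 = ∫ s in Iic t, 2 * (h (s, x) - c (s, x)) := fun x => by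
    have hsl : ContDiff ℝ ∞ fun s => v (s, x) := hv.comp (contDiff_id.prodMk contDiff_const)
    have k1 := HasCompactSupport.integral_Iic_deriv_eq (f := fun s => v (s, x) ^ 2)
      ((hsl.pow 2).of_le (by simp))
      ((hasCompactSupport_slice_left hvc x).mono fun p hp h => hp (by simp [h])) t
    rw [← k1]
    refine integral_congr_ae (Eventually.of_forall fun s => ?_)
    have hd := (hsl.differentiable (by simp) s).hasDerivAt.pow 2
    have hd' : deriv (fun s => v (s, x) ^ 2) s = _ := hd.deriv
    rw [deriv_slice_left hv] at hd'
    simp only [hd', h, c, timeDeriv]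
    ring
  have hprod : ∀ k : TimeSpace d → ℝ, Integrable k →
      ∫ x, ∫ s in Iic t, k (s, x) = ∫ p in Iic t ×ˢ univ, k p := fun k hk => by
    have hk' : Integrable k ((volume.restrict (Iic t)).prod (volume : Measure (Space d))) := by
      have := hk.restrict (s := Iic t ×ˢ univ)
      rwa [Measure.volume_eq_prod, ← Measure.prod_restrict, Measure.restrict_univ] at this
    rw [← integral_prod_symm _ hk', Measure.volume_eq_prod, ← Measure.prod_restrict,
      Measure.restrict_univ]
  have hc0 : ∫ p in Iic t ×ˢ univ, c p = 0 := by
    rw [Measure.volume_eq_prod, setIntegral_prod _ (by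
      rw [← Measure.volume_eq_prod]; exact hic.integrableOn)]
    simp only [Measure.restrict_univ, c, integral_slice_mul_divX hv hτ hτc, integral_zero]
  simp only [e1]
  rw [hprod (fun p => 2 * (h p - c p)) ((hih.sub hic).const_mul 2), integral_const_mul,
    integral_sub hih.restrict hic.restrict, hc0, sub_zero, ← integral_const_mul]
  refine (integral_mono (hih.const_mul 2).restrict hR.restrict fun p => ?_).trans
    (setIntegral_le_integral hR (Eventually.of_forall fun p => by positivity))
  have k1 := abs_real_inner_le_norm (gradX v p) (τ p)
  have k2 := le_abs_self (inner ℝ (gradX v p) (τ p))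
  simp only [h, Real.norm_eq_abs, sq_abs]
  -- Young's inequality `2ab ≤ a² + b²` for each of the two products in `2h`.
  nlinarith [sq_nonneg (‖gradX v p‖ - ‖τ p‖), sq_nonneg (v p - (timeDeriv v p + divX τ p))]

/-! ### Continuity in time -/

lemma ofReal_norm_sq {F : Type*} [NormedAddCommGroup F] (a : F) :
    ENNReal.ofReal (‖a‖ ^ 2) = ‖a‖ₑ ^ 2 := by
  rw [ENNReal.ofReal_pow (norm_nonneg a), ofReal_norm]

lemma eLpNorm_two_eq {α F : Type*} [MeasurableSpace α] {μ : Measure α} [NormedAddCommGroup F]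
    (u : α → F) : eLpNorm u 2 μ = (∫⁻ x, ‖u x‖ₑ ^ 2 ∂μ) ^ (1 / 2 : ℝ) := by
  rw [eLpNorm_eq_lintegral_rpow_enorm_toReal (by simp) (by simp)]
  simp

lemma lintegral_slice_sq_le {v : TimeSpace d → ℝ} {τ : TimeSpace d → Space d}
    (hv : ContDiff ℝ ∞ v) (hvc : HasCompactSupport v) (hτ : ContDiff ℝ ∞ τ)
    (hτc : HasCompactSupport τ) (t : ℝ) :
    ∫⁻ x, ‖v (t, x)‖ₑ ^ 2 ≤ (∫⁻ p, ‖v p‖ₑ ^ 2) + (∫⁻ p, ‖τ p‖ₑ ^ 2)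
      + (∫⁻ p, ‖gradX v p‖ₑ ^ 2) + ∫⁻ p, ‖timeDeriv v p + divX τ p‖ₑ ^ 2 := by
  have cv := hv.continuous
  have cτ := hτ.continuous
  have cg := continuous_gradX hv
  have cf := (continuous_timeDeriv hv).add (continuous_divX hτ)
  have hs : Continuous fun x => v (t, x) := cv.comp (by fun_prop)
  have hi : Integrable fun x => v (t, x) ^ 2 :=
    (hs.pow 2).integrable_of_hasCompactSupport
      ((hasCompactSupport_slice_right hvc t).mono fun p hp h => hp (by simp [h]))
  have h1 : ∫⁻ x, ‖v (t, x)‖ₑ ^ 2 = ENNReal.ofReal (∫ x, v (t, x) ^ 2) := by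
    rw [ofReal_integral_eq_lintegral_ofReal hi (Eventually.of_forall fun x => sq_nonneg _)]
    refine lintegral_congr fun x => ?_
    rw [← ofReal_norm_sq, Real.norm_eq_abs, sq_abs]
  rw [h1]
  refine (ENNReal.ofReal_le_ofReal (integral_slice_sq_le hv hvc hτ hτc t)).trans ?_
  have m1 : Measurable fun p => ‖v p‖ₑ ^ 2 := (cv.enorm.measurable).pow_const 2
  have m2 : Measurable fun p => ‖τ p‖ₑ ^ 2 := (cτ.enorm.measurable).pow_const 2
  have m3 : Measurable fun p => ‖gradX v p‖ₑ ^ 2 := (cg.enorm.measurable).pow_const 2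
  have m12 : Measurable fun p => ‖v p‖ₑ ^ 2 + ‖τ p‖ₑ ^ 2 := m1.add m2
  have m123 : Measurable fun p => ‖v p‖ₑ ^ 2 + ‖τ p‖ₑ ^ 2 + ‖gradX v p‖ₑ ^ 2 := m12.add m3
  rw [← lintegral_add_left m1, ← lintegral_add_left m12, ← lintegral_add_left m123]
  have cs : Continuous fun p => ‖timeDeriv v p + divX τ p‖ ^ 2 := cf.norm.pow 2
  rw [integral_eq_lintegral_of_nonneg_ae (Eventually.of_forall fun p => by positivity)
    (by fun_prop : Continuous _).aestronglyMeasurable]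
  refine ENNReal.ofReal_toReal_le.trans_eq ?_
  refine lintegral_congr fun p => ?_
  rw [ENNReal.ofReal_add (by positivity) (by positivity),
    ENNReal.ofReal_add (by positivity) (by positivity),
    ENNReal.ofReal_add (by positivity) (by positivity)]
  simp only [ofReal_norm_sq]

lemma lintegral_sub_sq_le {α F : Type*} [MeasurableSpace α] {μ : Measure α}
    [NormedAddCommGroup F] {a b c : α → F} (ha : StronglyMeasurable fun x => a x - c x) :
    ∫⁻ x, ‖a x - b x‖ₑ ^ 2 ∂μ
      ≤ 2 * ((∫⁻ x, ‖a x - c x‖ₑ ^ 2 ∂μ) + ∫⁻ x, ‖b x - c x‖ₑ ^ 2 ∂μ) := by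
  rw [← lintegral_add_left (ha.enorm.pow_const 2), ← lintegral_const_mul' _ _ (by simp)]
  refine lintegral_mono fun x => ?_
  have h : ‖a x - b x‖ ^ 2 ≤ 2 * (‖a x - c x‖ ^ 2 + ‖b x - c x‖ ^ 2) := by
    have := norm_sub_le (a x - c x) (b x - c x)
    rw [sub_sub_sub_cancel_right] at this
    nlinarith [sq_nonneg (‖a x - c x‖ - ‖b x - c x‖), norm_nonneg (a x - b x)]
  have h2 := ENNReal.ofReal_le_ofReal h
  rwa [ENNReal.ofReal_mul (by norm_num), ENNReal.ofReal_add (by positivity) (by positivity),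
    ofReal_norm_sq, ofReal_norm_sq, ofReal_norm_sq, ENNReal.ofReal_ofNat] at h2

/-- Letting `m → ∞` turns the Cauchy bound into the rate `S n`, uniformly in `t`, so the limit is
continuous. The rate is kept in the conclusion because it is needed to identify the limit. -/
lemma exists_continuous_limit {X H : Type*} [TopologicalSpace X] [PseudoEMetricSpace H]
    [CompleteSpace H] {w : ℕ → X → H} (hw : ∀ n, Continuous (w n)) {S : ℕ → ℝ≥0∞}
    (hS : Tendsto S atTop (𝓝 0)) (h : ∀ n m t, edist (w n t) (w m t) ≤ S n + S m) :
    ∃ u : X → H, Continuous u ∧ (∀ t, Tendsto (fun n => w n t) atTop (𝓝 (u t))) ∧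
      ∀ n t, edist (u t) (w n t) ≤ S n := by
  have hc : ∀ t, CauchySeq fun n => w n t := fun t => by
    refine EMetric.cauchySeq_iff.2 fun ε hε => ?_
    obtain ⟨N, hN⟩ := eventually_atTop.1
      (hS.eventually (gt_mem_nhds (ENNReal.half_pos hε.ne')))
    refine ⟨N, fun m hm n hn => (h m n t).trans_lt ?_⟩
    rw [← ENNReal.add_halves ε]
    exact ENNReal.add_lt_add (hN m hm) (hN n hn)
  choose u hu using fun t => cauchySeq_tendsto_of_complete (hc t)
  have hle : ∀ n t, edist (u t) (w n t) ≤ S n := fun n t => by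
    have h1 : Tendsto (fun m => edist (w m t) (w n t)) atTop (𝓝 (edist (u t) (w n t))) :=
      (hu t).edist tendsto_const_nhds
    have h2 : Tendsto (fun m => S m + S n) atTop (𝓝 (0 + S n)) := hS.add tendsto_const_nhds
    rw [zero_add] at h2
    exact le_of_tendsto_of_tendsto' h1 h2 fun m => h m n t
  refine ⟨u, ?_, hu, hle⟩
  have hun : TendstoUniformly w u atTop := EMetric.tendstoUniformly_iff.2 fun ε hε => by
    filter_upwards [hS.eventually (gt_mem_nhds hε)] with n hn t
    exact (hle n t).trans_lt hn
  exact hun.continuous (Eventually.of_forall hw).frequently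

lemma memLp_slice {v : TimeSpace d → ℝ} (hv : Continuous v) (hc : HasCompactSupport v) (t : ℝ)
    (Ω : Set (Space d)) : MemLp (fun x => v (t, x)) 2 (volume.restrict Ω) :=
  ((hv.comp (by fun_prop : Continuous fun x : Space d => (t, x))).memLp_of_hasCompactSupport
    (hasCompactSupport_slice_right hc t))

/-- A compactly supported continuous function is uniformly continuous, and on a set of finite
measure a uniform bound gives an `L²` bound. -/
lemma continuous_slice_toLp {Ω : Set (Space d)} (hΩ : Bornology.IsBounded Ω)
    {v : TimeSpace d → ℝ} (hv : Continuous v) (hc : HasCompactSupport v) :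
    Continuous fun t => (memLp_slice hv hc t Ω).toLp := by
  have hfin : IsFiniteMeasure (volume.restrict Ω) := ⟨by simpa using hΩ.measure_lt_top⟩
  have huc := Metric.uniformContinuous_iff.1 (hc.uniformContinuous_of_continuous hv)
  set M : ℝ := ↑(measureUnivNNReal (volume.restrict Ω)) ^ (2 : ℝ≥0∞).toReal⁻¹ with hM
  have hM0 : 0 ≤ M := by positivity
  refine Metric.continuous_iff.2 fun s ε hε => ?_
  -- `M` is the square root of the volume of `Ω`; `M + 1` avoids dividing by zero.
  obtain ⟨δ, hδ, h⟩ := huc (ε / (M + 1)) (by positivity)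
  refine ⟨δ, hδ, fun t ht => ?_⟩
  rw [dist_eq_norm, ← MemLp.toLp_sub]
  have hb := Lp.norm_le_of_ae_bound
    (f := ((memLp_slice hv hc t Ω).sub (memLp_slice hv hc s Ω)).toLp _)
    (C := ε / (M + 1)) (by positivity) (by
      filter_upwards [((memLp_slice hv hc t Ω).sub (memLp_slice hv hc s Ω)).coeFn_toLp] with x hx
      rw [hx, Pi.sub_apply, ← dist_eq_norm]
      refine (h ?_).le
      simpa [Prod.dist_eq] using ht)
  refine hb.trans_lt ?_
  rw [← hM, ← mul_div_assoc, div_lt_iff₀ (by positivity)]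
  nlinarith

/-- A square integrable function with square integrable weak `∇_x v` and `div (v, τ)` on the whole
time-space is continuous in time with values in `L²`. -/
lemma exists_continuous_representative {Ω : Set (Space d)} (hΩ : Bornology.IsBounded Ω)
    {V f : TimeSpace d → ℝ} {τ g : TimeSpace d → Space d}
    (mV : StronglyMeasurable V) (mτ : StronglyMeasurable τ) (mg : StronglyMeasurable g)
    (mf : StronglyMeasurable f) (lV : MemLp V 2) (lτ : MemLp τ 2) (lg : MemLp g 2) (lf : MemLp f 2)
    (cV : HasCompactSupport V) (cτ : HasCompactSupport τ)
    (hg : HasWeakGradX univ V g) (hf : HasWeakDiv univ V τ f)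
    (hV0 : ∀ t < 0, ∀ x, V (t, x) = 0) :
    ∃ u : ℝ → L2 Ω ℝ, Continuous u ∧
      (∀ᵐ t, u t =ᵐ[volume.restrict Ω] fun x => V (t, x)) ∧ u 0 = 0 := by
  have iV : LocallyIntegrable V := lV.locallyIntegrable (by norm_num)
  have iτ : LocallyIntegrable τ := lτ.locallyIntegrable (by norm_num)
  have ig : LocallyIntegrable g := lg.locallyIntegrable (by norm_num)
  have i_f : LocallyIntegrable f := lf.locallyIntegrable (by norm_num)
  let φ : ℕ → ContDiffBump (0 : TimeSpace d) := fun n =>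
    ⟨1 / (n + 1) / 2, 1 / (n + 1), by positivity, half_lt_self (by positivity)⟩
  have hφ : Tendsto (fun n => (φ n).rOut) atTop (𝓝 0) := tendsto_one_div_add_atTop_nhds_zero_nat
  let ρ : ℕ → TimeSpace d → ℝ := fun n => (φ n).normed volume
  have sρ : ∀ n, ContDiff ℝ ∞ (ρ n) := fun n => (φ n).contDiff_normed
  have cρ : ∀ n, HasCompactSupport (ρ n) := fun n => (φ n).hasCompactSupport_normed
  let v : ℕ → TimeSpace d → ℝ := fun n => mollify volume (ρ n) V
  have sv : ∀ n, ContDiff ℝ ∞ (v n) := fun n => contDiff_mollify iV (sρ n) (cρ n)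
  have cv : ∀ n, HasCompactSupport (v n) := fun n => hasCompactSupport_mollify cV (cρ n)
  let A : ℕ → ℝ≥0∞ := fun n => (∫⁻ p, ‖mollify volume (ρ n) V p - V p‖ₑ ^ 2)
    + (∫⁻ p, ‖mollify volume (ρ n) τ p - τ p‖ₑ ^ 2)
    + (∫⁻ p, ‖mollify volume (ρ n) g p - g p‖ₑ ^ 2)
    + ∫⁻ p, ‖mollify volume (ρ n) f p - f p‖ₑ ^ 2
  have hA : Tendsto A atTop (𝓝 0) := by
    have := (((tendsto_lintegral_mollify_sub mV lV hφ).add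
      (tendsto_lintegral_mollify_sub mτ lτ hφ)).add (tendsto_lintegral_mollify_sub mg lg hφ)).add
      (tendsto_lintegral_mollify_sub mf lf hφ)
    simpa using this
  -- The squared slice distance is at most `2 A n + 2 A m`; subadditivity of the square root splits
  -- it as `S n + S m`.
  let S : ℕ → ℝ≥0∞ := fun n => (2 * A n) ^ (1 / 2 : ℝ)
  have hS : Tendsto S atTop (𝓝 0) := by
    have h1 := ENNReal.Tendsto.const_mul (a := 2) hA (Or.inr (by simp))
    have h2 := h1.ennrpow_const (1 / 2)
    simpa [S] using h2
  have hslice : ∀ n m t, ∫⁻ x, ‖v n (t, x) - v m (t, x)‖ₑ ^ 2 ≤ 2 * A n + 2 * A m := by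
    intro n m t
    -- The energy estimate is applied with the kernel `ρ n - ρ m`. It is no longer a bump, but
    -- smoothness and compact support suffice for the derivative formulas.
    have sκ : ContDiff ℝ ∞ fun p => ρ n p - ρ m p := (sρ n).sub (sρ m)
    have cκ : HasCompactSupport fun p => ρ n p - ρ m p := (cρ n).sub (cρ m)
    have h1 := lintegral_slice_sq_le (contDiff_mollify iV sκ cκ) (hasCompactSupport_mollify cV cκ)
      (contDiff_mollify iτ sκ cκ) (hasCompactSupport_mollify cτ cκ) t
    simp only [gradX_mollify iV ig sκ cκ hg, timeDeriv_add_divX_mollify iV iτ sκ cκ hf] at h1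
    simp only [mollify_sub iV (sρ n).continuous (cρ n) (sρ m).continuous (cρ m),
      mollify_sub iτ (sρ n).continuous (cρ n) (sρ m).continuous (cρ m),
      mollify_sub ig (sρ n).continuous (cρ n) (sρ m).continuous (cρ m),
      mollify_sub i_f (sρ n).continuous (cρ n) (sρ m).continuous (cρ m)] at h1
    refine h1.trans ?_
    have k : ∀ {F : Type} [NormedAddCommGroup F] [NormedSpace ℝ F] [CompleteSpace F]
        {a : TimeSpace d → F}, StronglyMeasurable a → LocallyIntegrable a →
        ∫⁻ p, ‖mollify volume (ρ n) a p - mollify volume (ρ m) a p‖ₑ ^ 2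
          ≤ 2 * ((∫⁻ p, ‖mollify volume (ρ n) a p - a p‖ₑ ^ 2)
            + ∫⁻ p, ‖mollify volume (ρ m) a p - a p‖ₑ ^ 2) := fun ma ia =>
      lintegral_sub_sq_le
        ((contDiff_mollify ia (sρ n) (cρ n)).continuous.stronglyMeasurable.sub ma)
    refine (add_le_add (add_le_add (add_le_add (k mV iV) (k mτ iτ)) (k mg ig))
      (k mf i_f)).trans_eq ?_
    simp only [A]
    ring
  let w : ℕ → ℝ → L2 Ω ℝ := fun n t => (memLp_slice (sv n).continuous (cv n) t Ω).toLp
  have hw : ∀ n, Continuous (w n) := fun n => continuous_slice_toLp hΩ (sv n).continuous (cv n)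
  obtain ⟨u, hu, hlim, hle⟩ := exists_continuous_limit hw hS fun n m t => by
    refine le_trans ?_ (ENNReal.rpow_add_le_add_rpow (2 * A n) (2 * A m) (by norm_num)
      (by norm_num))
    rw [Lp.edist_toLp_toLp, eLpNorm_two_eq]
    refine ENNReal.rpow_le_rpow ((lintegral_mono' Measure.restrict_le_self le_rfl).trans
      (hslice n m t)) (by norm_num)
  refine ⟨u, hu, ?_, ?_⟩
  -- The slice errors `D n` tend to zero in `L¹(dt)`. Fatou's lemma gives `liminf D n t = 0` for
  -- almost every `t`, which replaces the choice of an a.e. convergent subsequence.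
  · let D : ℕ → ℝ → ℝ≥0∞ := fun n t => ∫⁻ x, ‖v n (t, x) - V (t, x)‖ₑ ^ 2
    have mD' : ∀ n, Measurable fun p => ‖v n p - V p‖ₑ ^ 2 := fun n =>
      ((sv n).continuous.stronglyMeasurable.sub mV).enorm.pow_const 2
    have mD : ∀ n, Measurable (D n) := fun n => (mD' n).lintegral_prod_right'
    have iD : Tendsto (fun n => ∫⁻ t, D n t) atTop (𝓝 0) := by
      refine (tendsto_lintegral_mollify_sub mV lV hφ).congr fun n => ?_
      have k := lintegral_prod (μ := (volume : Measure ℝ)) (ν := (volume : Measure (Space d))) _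
        (mD' n).aemeasurable
      rwa [← Measure.volume_eq_prod] at k
    have h0 : ∫⁻ t, liminf (fun n => D n t) atTop = 0 :=
      le_antisymm ((lintegral_liminf_le mD).trans_eq iD.liminf_eq) bot_le
    rw [lintegral_eq_zero_iff (Measurable.liminf mD)] at h0
    filter_upwards [h0] with t ht
    have mVt : AEStronglyMeasurable (fun x => V (t, x)) (volume.restrict Ω) :=
      (mV.comp_measurable measurable_prodMk_left).aestronglyMeasurable
    have mu : ∀ a : L2 Ω ℝ, AEStronglyMeasurable a (volume.restrict Ω) :=
      fun a => (Lp.stronglyMeasurable a).aestronglyMeasurable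
    have muV : ∀ a : L2 Ω ℝ, AEStronglyMeasurable (fun x => a x - V (t, x)) (volume.restrict Ω) :=
      fun a => (mu a).sub mVt
    have muw : ∀ a b : L2 Ω ℝ, AEStronglyMeasurable (fun x => a x - b x) (volume.restrict Ω) :=
      fun a b => (mu a).sub (mu b)
    have hz : eLpNorm (fun x => u t x - V (t, x)) 2 (volume.restrict Ω) = 0 := by
      refine le_antisymm (le_of_forall_gt fun ε hε => ?_) bot_le
      have hε2 : 0 < (ε / 2) ^ (2 : ℝ) := by
        refine ENNReal.rpow_pos_of_nonneg (ENNReal.half_pos hε.ne') (by norm_num)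
      -- Infinitely many `n` make `D n t` small and all large `n` make `S n` small, so one `n`
      -- serves both halves of the triangle inequality.
      have hfr := (frequently_lt_of_liminf_lt (f := atTop) (u := fun n => D n t)
        (b := (ε / 2) ^ (2 : ℝ)) (by isBoundedDefault) (by rw [ht]; exact hε2)).and_eventually
          (hS.eventually (gt_mem_nhds (ENNReal.half_pos hε.ne')))
      obtain ⟨n, hn1, hn2⟩ := hfr.exists
      have e : (fun x => u t x - V (t, x))
          = (fun x => u t x - w n t x) + fun x => w n t x - V (t, x) := by
        ext x
        simp
      rw [e, ← ENNReal.add_halves ε]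
      refine (eLpNorm_add_le (muw _ _) (muV _) (by norm_num)).trans_lt
        (ENNReal.add_lt_add ?_ ?_)
      · have h1 := (hle n t).trans_lt hn2
        rwa [Lp.edist_def] at h1
      · have e2 : eLpNorm (fun x => w n t x - V (t, x)) 2 (volume.restrict Ω)
            = eLpNorm (fun x => v n (t, x) - V (t, x)) 2 (volume.restrict Ω) := by
          refine eLpNorm_congr_ae ?_
          filter_upwards [(memLp_slice (sv n).continuous (cv n) t Ω).coeFn_toLp] with x hx
          rw [hx]
        rw [e2]
        refine (eLpNorm_mono_measure _ Measure.restrict_le_self).trans_lt ?_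
        rw [eLpNorm_two_eq]
        refine (ENNReal.rpow_lt_rpow hn1 (z := 1 / 2) (by norm_num)).trans_eq ?_
        rw [← ENNReal.rpow_mul]
        norm_num
    rw [eLpNorm_eq_zero_iff (muV _) (by norm_num)] at hz
    filter_upwards [hz] with x hx
    exact sub_eq_zero.1 hx
  -- For `t < 0` the kernel eventually has radius below `-t` and sees only negative times, where `V
  -- = 0`. Continuity carries `u = 0` up to `t = 0`.
  · have hneg : ∀ t < 0, u t = 0 := by
      intro t ht
      refine tendsto_nhds_unique (hlim t) (tendsto_const_nhds.congr' ?_)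
      filter_upwards [hφ.eventually (gt_mem_nhds (neg_pos.2 ht))] with n hn
      have hv0 : ∀ x, v n (t, x) = 0 := fun x => by
        refine integral_eq_zero_of_ae (Eventually.of_forall fun y => ?_)
        by_cases hy : y.1 < 0
        · simp [hV0 y.1 hy y.2]
        · have : ρ n ((t, x) - y) = 0 := by
            rw [← Function.notMem_support]
            intro hs
            rw [(φ n).support_normed_eq, mem_ball_zero_iff] at hs
            have h1 := (norm_fst_le ((t, x) - y)).trans_lt hs
            rw [Prod.fst_sub, Real.norm_eq_abs, abs_lt] at h1
            simp only at h1
            linarith [not_lt.1 hy]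
          simp [this]
      symm
      have : (fun x => v n (t, x)) = 0 := funext hv0
      simp only [w, this]
      exact MemLp.toLp_zero _
    have hcl : closure (Iio (0 : ℝ)) ⊆ {t | u t = 0} :=
      closure_minimal hneg (isClosed_eq hu continuous_const)
    exact hcl (by rw [closure_Iio]; exact self_mem_Iic)

/-! ### Restrictions of continuous functions to bounded sets -/

section Restriction

variable {F : Type*} [NormedAddCommGroup F]

lemma memLp_of_continuous {Q : Set (TimeSpace d)} (hQ : Bornology.IsBounded Q)
    {u : TimeSpace d → F} (hu : Continuous u) : MemLp u 2 (volume.restrict Q) := by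
  have hfin : IsFiniteMeasure (volume.restrict Q) := ⟨by simpa using hQ.measure_lt_top⟩
  obtain ⟨C, hC⟩ := hQ.isCompact_closure.exists_bound_of_continuousOn hu.continuousOn
  refine MemLp.of_bound hu.aestronglyMeasurable C ?_
  have h : ∀ᵐ p ∂volume.restrict (closure Q), ‖u p‖ ≤ C :=
    ae_restrict_of_forall_mem isClosed_closure.measurableSet hC
  exact ae_mono (Measure.restrict_mono subset_closure le_rfl) h

/-- The class in `L²(Q)` of a continuous function on the whole space. -/
def restrictL2 {Q : Set (TimeSpace d)} (hQ : Bornology.IsBounded Q) {u : TimeSpace d → F}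
    (hu : Continuous u) : L2 Q F := (memLp_of_continuous hQ hu).toLp u

lemma coeFn_restrictL2 {Q : Set (TimeSpace d)} (hQ : Bornology.IsBounded Q)
    {u : TimeSpace d → F} (hu : Continuous u) : restrictL2 hQ hu =ᵐ[volume.restrict Q] u :=
  (memLp_of_continuous hQ hu).coeFn_toLp

variable [InnerProductSpace ℝ F]

lemma inner_restrictL2 {Q : Set (TimeSpace d)} (hQ : Bornology.IsBounded Q)
    {u : TimeSpace d → F} (hu : Continuous u) (a : L2 Q F) :
    inner ℝ a (restrictL2 hQ hu) = ∫ p in Q, inner ℝ (a p) (u p) := by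
  rw [MeasureTheory.L2.inner_def]
  refine integral_congr_ae ?_
  filter_upwards [coeFn_restrictL2 hQ hu] with p hp
  rw [hp]

lemma integrable_inner_continuous {Q : Set (TimeSpace d)} (hQ : Bornology.IsBounded Q)
    {u : TimeSpace d → F} (hu : Continuous u) (a : L2 Q F) :
    Integrable (fun p => inner ℝ (a p) (u p)) (volume.restrict Q) := by
  refine (L2.integrable_inner (𝕜 := ℝ) a (restrictL2 hQ hu)).congr ?_
  filter_upwards [coeFn_restrictL2 hQ hu] with p hp
  rw [hp]

end Restriction

lemma inner_pair {Q : Set (TimeSpace d)} (a b : L2Pair Q) :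
    inner ℝ a b = inner ℝ a.fst b.fst + inner ℝ a.snd b.snd :=
  WithLp.prod_inner_apply a b

/-! ### The graph of `A` on `U₀` -/

/-- `z = A v` for `v ∈ U₀`, expressed by test functions. -/
structure IsGraphU0 {Q : Set (TimeSpace d)} (v z : L2Pair Q) : Prop where
  div : HasWeakDiv Q v.fst v.snd z.fst
  grad : ∀ χ : TimeSpace d → Space d, ContDiff ℝ ∞ χ →
    ∫ p in Q, inner ℝ ((z.snd - v.snd) p) (χ p) = - ∫ p in Q, v.fst p * divX χ p

lemma IsGraphU0.hasWeakGradX {Q : Set (TimeSpace d)} {v z : L2Pair Q} (h : IsGraphU0 v z) :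
    HasWeakGradX Q v.fst (z.snd - v.snd : L2 Q (Space d)) := fun χ h1 _ _ => by
  rw [h.grad χ h1, neg_neg]

/-- Weak derivatives are unique on an open set, so the chosen ones in `opA` must be those read off
from `z`. -/
lemma IsGraphU0.opA_eq {Q : Set (TimeSpace d)} (hQ : IsOpen Q) {v z : L2Pair Q}
    (h : IsGraphU0 v z) : opA v = z := by
  have e1 : weakDiv Q v.fst v.snd = z.fst := Lp.ext <|
    HasWeakDiv.unique hQ (Lp.memLp _) (Lp.memLp _) (weakDiv_spec ⟨_, h.div⟩) h.div
  have e2 : weakGradX Q v.fst = z.snd - v.snd := Lp.ext <|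
    HasWeakGradX.unique hQ (Lp.memLp _) (Lp.memLp _) (weakGradX_spec ⟨_, h.hasWeakGradX⟩)
      h.hasWeakGradX
  refine (WithLp.ofLp_injective 2) (Prod.ext e1 ?_)
  change weakGradX Q v.fst + v.snd = z.snd
  rw [e2, sub_add_cancel]

lemma IsGraphU0.mem {Q : Set (TimeSpace d)} (hQ : IsOpen Q) {v z : L2Pair Q}
    (h : IsGraphU0 v z) : v ∈ spaceU0 Q := by
  refine ⟨⟨⟨_, h.hasWeakGradX⟩, ⟨_, h.div⟩⟩, fun χ hχ => ?_⟩
  have e2 : weakGradX Q v.fst = z.snd - v.snd := Lp.ext <|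
    HasWeakGradX.unique hQ (Lp.memLp _) (Lp.memLp _) (weakGradX_spec ⟨_, h.hasWeakGradX⟩)
      h.hasWeakGradX
  rw [e2, h.grad χ hχ]

lemma isGraphU0_opA {Q : Set (TimeSpace d)} {v : L2Pair Q} (h : v ∈ spaceU0 Q) :
    IsGraphU0 v (opA v) := by
  refine ⟨weakDiv_spec h.1.2, fun χ hχ => ?_⟩
  rw [← h.2 χ hχ]
  have e : (opA v).snd - v.snd = weakGradX Q v.fst := add_sub_cancel_right _ _
  rw [e]

/-- As inner products with fixed `L²` functions the conditions are visibly linear in `(v, z)`.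
Boundedness of `Q` puts the restrictions of all smooth tests into `L²`. -/
lemma isGraphU0_iff {Q : Set (TimeSpace d)} (hQ : Bornology.IsBounded Q) {v z : L2Pair Q} :
    IsGraphU0 v z ↔
      (∀ (φ : TimeSpace d → ℝ) (h : ContDiff ℝ ∞ φ), HasCompactSupport φ → tsupport φ ⊆ Q →
        inner ℝ v.fst (restrictL2 hQ (continuous_timeDeriv h))
          + inner ℝ v.snd (restrictL2 hQ (continuous_gradX h))
          = - inner ℝ z.fst (restrictL2 hQ h.continuous)) ∧
      ∀ (χ : TimeSpace d → Space d) (h : ContDiff ℝ ∞ χ),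
        inner ℝ (z.snd - v.snd) (restrictL2 hQ h.continuous)
          = - inner ℝ v.fst (restrictL2 hQ (continuous_divX h)) := by
  have hd : ∀ (φ : TimeSpace d → ℝ) (h : ContDiff ℝ ∞ φ),
      (∫ p in Q, (v.fst p * timeDeriv φ p + inner ℝ (v.snd p) (gradX φ p))
        = - ∫ p in Q, z.fst p * φ p) ↔ inner ℝ v.fst (restrictL2 hQ (continuous_timeDeriv h))
          + inner ℝ v.snd (restrictL2 hQ (continuous_gradX h))
          = - inner ℝ z.fst (restrictL2 hQ h.continuous) := fun φ h => by
    rw [inner_restrictL2, inner_restrictL2, inner_restrictL2, ← integral_add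
      (integrable_inner_continuous hQ (continuous_timeDeriv h) _)
      (integrable_inner_continuous hQ (continuous_gradX h) _)]
    simp only [inner_eq_mul]
  have hg : ∀ (χ : TimeSpace d → Space d) (h : ContDiff ℝ ∞ χ),
      (∫ p in Q, inner ℝ ((z.snd - v.snd) p) (χ p) = - ∫ p in Q, v.fst p * divX χ p) ↔
        inner ℝ (z.snd - v.snd) (restrictL2 hQ h.continuous)
          = - inner ℝ v.fst (restrictL2 hQ (continuous_divX h)) := fun χ h => by
    rw [inner_restrictL2, inner_restrictL2]
    simp only [inner_eq_mul]
  exact ⟨fun h => ⟨fun φ h1 h2 h3 => (hd φ h1).1 (h.div φ h1 h2 h3),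
      fun χ h1 => (hg χ h1).1 (h.grad χ h1)⟩,
    fun h => ⟨fun φ h1 h2 h3 => (hd φ h1).2 (h.1 φ h1 h2 h3), fun χ h1 => (hg χ h1).2 (h.2 χ h1)⟩⟩

lemma IsGraphU0.add {Q : Set (TimeSpace d)} (hQ : Bornology.IsBounded Q) {v z v' z' : L2Pair Q}
    (h : IsGraphU0 v z) (h' : IsGraphU0 v' z') : IsGraphU0 (v + v') (z + z') := by
  rw [isGraphU0_iff hQ] at *
  refine ⟨fun φ h1 h2 h3 => ?_, fun χ h1 => ?_⟩
  · have k := h.1 φ h1 h2 h3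
    have k' := h'.1 φ h1 h2 h3
    simp only [WithLp.add_fst, WithLp.add_snd, inner_add_left]
    linarith
  · have k := h.2 χ h1
    have k' := h'.2 χ h1
    simp only [WithLp.add_fst, WithLp.add_snd, inner_add_left, inner_sub_left] at *
    linarith

lemma IsGraphU0.zero {Q : Set (TimeSpace d)} (hQ : Bornology.IsBounded Q) :
    IsGraphU0 (0 : L2Pair Q) 0 := by
  rw [isGraphU0_iff hQ]
  exact ⟨fun φ h1 h2 h3 => by simp, fun χ h1 => by simp⟩

/-! ### Initial values -/

section InitialTrace

variable {T : ℝ} {Ω : Set (Space d)}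

lemma ae_ae_of_ae_cylinder {P : TimeSpace d → Prop}
    (h : ∀ᵐ p ∂(volume.restrict (cylinder T Ω)), P p) :
    ∀ᵐ t ∂(volume.restrict (Ioo 0 T)), ∀ᵐ x ∂(volume.restrict Ω), P (t, x) := by
  rw [cylinder, Measure.volume_eq_prod, ← Measure.prod_restrict] at h
  exact Measure.ae_ae_of_ae_prod h

lemma HasInitialTrace.add {v v' : L2Pair (cylinder T Ω)} {g g' : L2 Ω ℝ}
    (h : HasInitialTrace T Ω v.fst g) (h' : HasInitialTrace T Ω v'.fst g') :
    HasInitialTrace T Ω (v + v').fst (g + g') := by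
  obtain ⟨u, hu, hv, rfl⟩ := h
  obtain ⟨u', hu', hv', rfl⟩ := h'
  refine ⟨fun t => u t + u' t, hu.add hu', ?_, rfl⟩
  filter_upwards [hv, hv', ae_ae_of_ae_cylinder (Lp.coeFn_add v.fst v'.fst)] with t h1 h2 h3
  filter_upwards [h1, h2, h3, Lp.coeFn_add (u t) (u' t)] with x k1 k2 k3 k4
  rw [k4, Pi.add_apply, k1, k2]
  exact k3.symm

lemma HasInitialTrace.neg {v : L2Pair (cylinder T Ω)} {g : L2 Ω ℝ}
    (h : HasInitialTrace T Ω v.fst g) : HasInitialTrace T Ω (-v).fst (-g) := by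
  obtain ⟨u, hu, hv, rfl⟩ := h
  refine ⟨fun t => - u t, hu.neg, ?_, rfl⟩
  filter_upwards [hv, ae_ae_of_ae_cylinder (Lp.coeFn_neg v.fst)] with t h1 h3
  filter_upwards [h1, h3, Lp.coeFn_neg (u t)] with x k1 k3 k4
  rw [k4, Pi.neg_apply, k1]
  exact k3.symm

/-- If `p - q` has initial value zero, then `p` and `q` have the same initial values. -/
lemma hasInitialTrace_congr {p q : L2Pair (cylinder T Ω)}
    (h : HasInitialTrace T Ω (p - q).fst 0) :
    HasInitialTrace T Ω p.fst = HasInitialTrace T Ω q.fst := by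
  ext g
  constructor
  · intro hp
    have := hp.add h.neg
    rwa [neg_sub, add_sub_cancel, neg_zero, add_zero] at this
  · intro hq
    have := hq.add h
    rwa [add_sub_cancel, add_zero] at this

/-- `initialTrace` depends only on the predicate `HasInitialTrace`. Equal predicates give the same
chosen value, or the default `0` twice, so neither existence nor uniqueness of the initial value is
needed. -/
lemma initialTrace_congr {p q : L2Pair (cylinder T Ω)}
    (h : HasInitialTrace T Ω (p - q).fst 0) : initialTrace p = initialTrace q := by
  classical
  have e : ∀ v : L2Pair (cylinder T Ω), initialTrace v
      = (fun P : L2 Ω ℝ → Prop => if h : ∃ g, P g then h.choose else 0)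
        (HasInitialTrace T Ω v.fst) := fun v => by
    simp only [initialTrace]
  rw [e p, e q, hasInitialTrace_congr h]

lemma initialTrace_zero (hT : 0 < T) : initialTrace (0 : L2Pair (cylinder T Ω)) = 0 := by
  have hex : ∃ g, HasInitialTrace T Ω (0 : L2Pair (cylinder T Ω)).fst g := by
    refine ⟨0, fun _ => 0, continuousOn_const, ?_, rfl⟩
    filter_upwards [ae_ae_of_ae_cylinder (Lp.coeFn_zero ℝ 2 (volume.restrict (cylinder T Ω)))]
      with t h1
    filter_upwards [h1, Lp.coeFn_zero ℝ 2 (volume.restrict Ω)] with x k1 k2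
    rw [k2]
    exact k1.symm
  rw [initialTrace, dif_pos hex]
  obtain ⟨u, hu, hv, h0⟩ := hex.choose_spec
  rw [← h0]
  -- The chosen representative could be any one; it vanishes for almost every time and is continuous
  -- on `[0, T]`, hence vanishes at `0`.
  have hae : u =ᵐ[volume.restrict (Icc 0 T)] fun _ => 0 := by
    rw [← Measure.restrict_congr_set Ioo_ae_eq_Icc]
    filter_upwards [hv,
      ae_ae_of_ae_cylinder (Lp.coeFn_zero ℝ 2 (volume.restrict (cylinder T Ω)))] with t h1 h2
    refine Lp.ext ?_
    filter_upwards [h1, h2, Lp.coeFn_zero ℝ 2 (volume.restrict Ω)] with x k1 k2 k3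
    rw [k1, k3]
    exact k2
  exact Measure.eqOn_of_ae_eq hae hu continuousOn_const
    (by rw [interior_Icc, closure_Ioo hT.ne]) ⟨le_rfl, hT.le⟩

end InitialTrace

/-! ### Adjoint pairs for `A^*_h` -/

section Adjoint

variable {Q : Set (TimeSpace d)} (𝒯 : Mesh Q)

lemma HasWeakGradX.congr_left {K : Set (TimeSpace d)} {v v' : TimeSpace d → ℝ}
    {g : TimeSpace d → Space d} (h : HasWeakGradX K v g) (hv : v =ᵐ[volume.restrict K] v') :
    HasWeakGradX K v' g := by
  intro φ h1 h2 h3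
  rw [← h φ h1 h2 h3]
  refine integral_congr_ae ?_
  filter_upwards [hv] with p hp
  rw [hp]

lemma HasWeakDiv.congr_left {K : Set (TimeSpace d)} {v v' : TimeSpace d → ℝ}
    {τ τ' : TimeSpace d → Space d} {f : TimeSpace d → ℝ} (h : HasWeakDiv K v τ f)
    (hv : v =ᵐ[volume.restrict K] v') (hτ : τ =ᵐ[volume.restrict K] τ') :
    HasWeakDiv K v' τ' f := by
  intro φ h1 h2 h3
  rw [← h φ h1 h2 h3]
  refine integral_congr_ae ?_
  filter_upwards [hv, hτ] with p hp hp'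
  rw [hp, hp']

/-- `⟨e, A^*_h w⟩ = ⟨f, w⟩` for all broken test functions `w`. -/
def IsAdjointPair (e f : L2Pair Q) : Prop :=
  ∀ w ∈ brokenSpace 𝒯, inner ℝ e (brokenAstar 𝒯 w) = inner ℝ f w

variable (hQ : Bornology.IsBounded Q)
include hQ

/-- Supplies the broken test functions without any condition on `∂Q`; these carry the boundary
information about adjoint pairs. -/
lemma isBrokenAstar_smooth {φ : TimeSpace d → ℝ} {χ : TimeSpace d → Space d}
    (hφ : ContDiff ℝ ∞ φ) (hχ : ContDiff ℝ ∞ χ) :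
    IsBrokenAstar 𝒯 (WithLp.toLp 2 (restrictL2 hQ hφ.continuous, restrictL2 hQ hχ.continuous))
      (WithLp.toLp 2
        (- (restrictL2 hQ (continuous_timeDeriv hφ) + restrictL2 hQ (continuous_divX hχ)),
        restrictL2 hQ hχ.continuous - restrictL2 hQ (continuous_gradX hφ))) := by
  intro i
  have hle : volume.restrict (𝒯.cell i) ≤ volume.restrict Q :=
    Measure.restrict_mono (𝒯.cell_subset i) le_rfl
  have cφ : restrictL2 hQ hφ.continuous =ᵐ[volume.restrict (𝒯.cell i)] φ :=
    ae_mono hle (coeFn_restrictL2 hQ hφ.continuous)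
  have cχ : restrictL2 hQ hχ.continuous =ᵐ[volume.restrict (𝒯.cell i)] χ :=
    ae_mono hle (coeFn_restrictL2 hQ hχ.continuous)
  refine ⟨((hasWeakDiv_of_contDiff _ hφ hχ).congr_left cφ.symm cχ.symm).congr ?_,
    ((hasWeakGradX_of_contDiff _ hφ).congr_left cφ.symm).congr ?_⟩
  · filter_upwards [ae_mono hle (coeFn_restrictL2 hQ (continuous_timeDeriv hφ)),
      ae_mono hle (coeFn_restrictL2 hQ (continuous_divX hχ)),
      ae_mono hle (Lp.coeFn_neg (restrictL2 hQ (continuous_timeDeriv hφ)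
        + restrictL2 hQ (continuous_divX hχ))),
      ae_mono hle (Lp.coeFn_add (restrictL2 hQ (continuous_timeDeriv hφ))
        (restrictL2 hQ (continuous_divX hχ)))] with p k1 k2 k3 k4
    change _ = - (- (restrictL2 hQ (continuous_timeDeriv hφ)
        + restrictL2 hQ (continuous_divX hχ)) : L2 Q ℝ) p
    rw [k3, Pi.neg_apply, k4, Pi.add_apply, k1, k2, neg_neg]
  · filter_upwards [ae_mono hle (coeFn_restrictL2 hQ (continuous_gradX hφ)),
      ae_mono hle (Lp.coeFn_sub (restrictL2 hQ hχ.continuous)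
        (restrictL2 hQ (continuous_gradX hφ)))] with p k1 k2
    change _ = restrictL2 hQ hχ.continuous p - (restrictL2 hQ hχ.continuous
      - restrictL2 hQ (continuous_gradX hφ) : L2 Q (Space d)) p
    rw [k2, Pi.sub_apply, k1, sub_sub_cancel]

variable {𝒯}

lemma IsAdjointPair.inner_smooth {e f : L2Pair Q} (h : IsAdjointPair 𝒯 e f)
    {φ : TimeSpace d → ℝ} {χ : TimeSpace d → Space d} (hφ : ContDiff ℝ ∞ φ)
    (hχ : ContDiff ℝ ∞ χ) :
    - (inner ℝ e.fst (restrictL2 hQ (continuous_timeDeriv hφ))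
        + inner ℝ e.fst (restrictL2 hQ (continuous_divX hχ)))
      + (inner ℝ e.snd (restrictL2 hQ hχ.continuous)
        - inner ℝ e.snd (restrictL2 hQ (continuous_gradX hφ)))
      = inner ℝ f.fst (restrictL2 hQ hφ.continuous)
        + inner ℝ f.snd (restrictL2 hQ hχ.continuous) := by
  have hb := isBrokenAstar_smooth 𝒯 hQ hφ hχ
  have k := h _ hb.inGraphSpace
  rw [hb.eq, inner_pair, inner_pair] at k
  change inner ℝ e.fst (-(_ + _)) + inner ℝ e.snd (_ - _) = inner ℝ f.fst _ + inner ℝ f.snd _ at k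
  rwa [inner_neg_right, inner_add_right, inner_sub_right] at k

lemma restrictL2_eq_zero {F : Type*} [NormedAddCommGroup F] {u : TimeSpace d → F}
    (hu : Continuous u) (h0 : ∀ p, u p = 0) : restrictL2 hQ hu = 0 := by
  refine Lp.ext ?_
  filter_upwards [coeFn_restrictL2 hQ hu, Lp.coeFn_zero F 2 (volume.restrict Q)] with p h1 h2
  rw [h1, h2, h0]
  rfl

/-- The case `χ = 0`. The absence of a support condition on `φ` encodes the vanishing of `e` at the
initial time. -/
lemma IsAdjointPair.inner_fst {e f : L2Pair Q} (h : IsAdjointPair 𝒯 e f)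
    {φ : TimeSpace d → ℝ} (hφ : ContDiff ℝ ∞ φ) :
    inner ℝ e.fst (restrictL2 hQ (continuous_timeDeriv hφ))
      + inner ℝ e.snd (restrictL2 hQ (continuous_gradX hφ))
      = - inner ℝ f.fst (restrictL2 hQ hφ.continuous) := by
  have hχ : ContDiff ℝ ∞ fun _ : TimeSpace d => (0 : Space d) := contDiff_const
  have k := h.inner_smooth hQ hφ hχ
  rw [restrictL2_eq_zero hQ (continuous_divX hχ) (fun p => by simp [divX]),
    restrictL2_eq_zero hQ hχ.continuous fun _ => rfl] at k
  simp only [inner_zero_right] at k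
  linarith

/-- The case `φ = 0`; this is the lateral boundary condition in `U₀`. -/
lemma IsAdjointPair.inner_snd {e f : L2Pair Q} (h : IsAdjointPair 𝒯 e f)
    {χ : TimeSpace d → Space d} (hχ : ContDiff ℝ ∞ χ) :
    inner ℝ (f.snd - e.snd) (restrictL2 hQ hχ.continuous)
      = - inner ℝ e.fst (restrictL2 hQ (continuous_divX hχ)) := by
  have hφ : ContDiff ℝ ∞ fun _ : TimeSpace d => (0 : ℝ) := contDiff_const
  have k := h.inner_smooth hQ hφ hχ
  rw [restrictL2_eq_zero hQ (continuous_timeDeriv hφ) (fun p => by simp [timeDeriv]),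
    restrictL2_eq_zero hQ (continuous_gradX hφ) (fun p => by ext; simp [gradX]),
    restrictL2_eq_zero hQ hφ.continuous fun _ => rfl] at k
  simp only [inner_zero_right] at k
  rw [inner_sub_left]
  linarith

lemma IsAdjointPair.isGraphU0 {e f : L2Pair Q} (h : IsAdjointPair 𝒯 e f) : IsGraphU0 e f :=
  (isGraphU0_iff hQ).2 ⟨fun _ h1 _ _ => h.inner_fst hQ h1, fun _ h1 => h.inner_snd hQ h1⟩

end Adjoint

lemma isBounded_cylinder {T : ℝ} {Ω : Set (Space d)} (hΩ : Bornology.IsBounded Ω) :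
    Bornology.IsBounded (cylinder T Ω) := (Metric.isBounded_Ioo 0 T).prod hΩ

/-- Functions in the domain of the adjoint of `A^*_h` on all broken functions vanish at the
initial time. -/
lemma IsAdjointPair.hasInitialTrace_zero {T : ℝ} {Ω : Set (Space d)} (hΩo : IsOpen Ω)
    (hΩ : Bornology.IsBounded Ω) {𝒯 : Mesh (cylinder T Ω)} {e f : L2Pair (cylinder T Ω)}
    (h : IsAdjointPair 𝒯 e f) : HasInitialTrace T Ω e.fst 0 := by
  have hQ : Bornology.IsBounded (cylinder T Ω) := isBounded_cylinder hΩ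
  have hQm : MeasurableSet (cylinder T Ω) := measurableSet_Ioo.prod hΩo.measurableSet
  have hs : ∀ {F : Type} [NormedAddCommGroup F] (a : L2 (cylinder T Ω) F), 
      StronglyMeasurable ((cylinder T Ω).indicator a) := fun a => (Lp.stronglyMeasurable a).indicator hQm
  have hm : ∀ {F : Type} [NormedAddCommGroup F] (a : L2 (cylinder T Ω) F), MemLp ((cylinder T Ω).indicator a) 2 :=
    fun a => (memLp_indicator_iff_restrict hQm).2 (Lp.memLp a)
  have hc : ∀ {F : Type} [NormedAddCommGroup F] (a : L2 (cylinder T Ω) F), 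
      HasCompactSupport ((cylinder T Ω).indicator a) := fun a => HasCompactSupport.of_support_subset_isCompact hQ.isCompact_closure
      (support_indicator_subset.trans subset_closure)
  have hext : ∀ {F : Type} [NormedAddCommGroup F] [InnerProductSpace ℝ F] (a : L2 (cylinder T Ω) F)
      (u : TimeSpace d → F) (hu : Continuous u),
      ∫ p, inner ℝ ((cylinder T Ω).indicator a p) (u p) = inner ℝ a (restrictL2 hQ hu) := by
    intro F _ _ a u hu
    rw [inner_restrictL2, ← integral_indicator hQm]
    refine integral_congr_ae (Eventually.of_forall fun p => ?_)
    by_cases hp : p ∈ cylinder T Ω <;> simp [hp]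
  have hint : ∀ {F : Type} [NormedAddCommGroup F] [InnerProductSpace ℝ F] (a : L2 (cylinder T Ω) F)
      (u : TimeSpace d → F) (hu : Continuous u),
      Integrable fun p => inner ℝ ((cylinder T Ω).indicator a p) (u p) := by
    intro F _ _ a u hu
    refine ((integrable_indicator_iff hQm).2 (integrable_inner_continuous hQ hu a)).congr
      (Eventually.of_forall fun p => ?_)
    by_cases hp : p ∈ cylinder T Ω <;> simp [hp]
  -- Extension by zero keeps the weak equations on the whole space, without boundary terms, because
  -- `inner_fst` and `inner_snd` hold for tests that do not vanish on `∂Q`.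
  obtain ⟨u, hu, hae, h0⟩ := exists_continuous_representative hΩ (hs e.fst) (hs e.snd)
    (hs (f.snd - e.snd)) (hs f.fst) (hm _) (hm _) (hm _) (hm _) (hc _) (hc _)
    (by
      intro χ h1 h2 h3
      rw [Measure.restrict_univ, hext _ _ h1.continuous, h.inner_snd hQ h1, neg_neg,
        ← hext _ _ (continuous_divX h1)]
      simp only [inner_eq_mul])
    (by
      intro φ h1 h2 h3
      rw [Measure.restrict_univ]
      simp only [← inner_eq_mul]
      rw [integral_add (hint _ _ (continuous_timeDeriv h1)) (hint _ _ (continuous_gradX h1)),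
        hext _ _ (continuous_timeDeriv h1), hext _ _ (continuous_gradX h1),
        hext _ _ h1.continuous, h.inner_fst hQ h1])
    (by
      intro t ht x
      refine indicator_of_notMem (fun hx => ?_) _
      exact absurd hx.1.1 (not_lt.2 ht.le))
  refine ⟨u, hu.continuousOn, ?_, h0⟩
  filter_upwards [ae_restrict_of_ae hae, ae_restrict_mem measurableSet_Ioo] with t h1 h2
  filter_upwards [h1, ae_restrict_mem hΩo.measurableSet] with x k1 k2
  rw [k1, indicator_of_mem (show (t, x) ∈ cylinder T Ω from ⟨h2, k2⟩)]

/-! ### The extension operator -/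

section Extension

variable {T : ℝ} {Ω : Set (Space d)} {𝒯 : Mesh (cylinder T Ω)}

lemma inner_trialToTest (v : L2Pair (cylinder T Ω)) (t : StrongDual ℝ (TestSpace 𝒯))
    (y : TestSpace 𝒯) : inner ℝ (trialToTest 𝒯 v t) y = formB 𝒯 v t y := by
  rw [← InnerProductSpace.toDual_apply_apply (𝕜 := ℝ), trialToTest,
    LinearIsometryEquiv.apply_symm_apply]

lemma traceA_apply (q : L2Pair (cylinder T Ω)) (y : TestSpace 𝒯) :
    traceA 𝒯 q y = inner ℝ (opA q) (TestSpace.fnLin 𝒯 y)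
      - inner ℝ q (TestSpace.astarLin 𝒯 y) + inner ℝ (initialTrace q) (TestSpace.initLin 𝒯 y) :=
  rfl

lemma formB_apply (v : L2Pair (cylinder T Ω)) (t : StrongDual ℝ (TestSpace 𝒯))
    (y : TestSpace 𝒯) : formB 𝒯 v t y = inner ℝ v (TestSpace.astarLin 𝒯 y) + t y := rfl

lemma fnLin_trialToTest (v : L2Pair (cylinder T Ω)) (t : StrongDual ℝ (TestSpace 𝒯)) :
    TestSpace.fnLin 𝒯 (trialToTest 𝒯 v t) = trialToTest₁ 𝒯 v t := rfl

lemma astarLin_trialToTest (v : L2Pair (cylinder T Ω)) (t : StrongDual ℝ (TestSpace 𝒯)) :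
    TestSpace.astarLin 𝒯 (trialToTest 𝒯 v t) = v - extension 𝒯 v t :=
  (sub_sub_cancel v _).symm

lemma trialToTest₁_mem (v : L2Pair (cylinder T Ω)) (t : StrongDual ℝ (TestSpace 𝒯)) :
    trialToTest₁ 𝒯 v t ∈ brokenSpace 𝒯 := (trialToTest 𝒯 v t).1.2

lemma brokenAstar_trialToTest₁ (v : L2Pair (cylinder T Ω)) (t : StrongDual ℝ (TestSpace 𝒯)) :
    brokenAstar 𝒯 (trialToTest₁ 𝒯 v t) = v - extension 𝒯 v t :=
  (sub_sub_cancel v _).symm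

/-- The Riesz equation tested with `(w, 0)`, after moving the terms with `A_h^* w` to one side. It
uses nothing about `q`. -/
lemma isAdjointPair_extension_sub (v q : L2Pair (cylinder T Ω)) :
    IsAdjointPair 𝒯 (extension 𝒯 v (traceA 𝒯 q) - q) (trialToTest₁ 𝒯 v (traceA 𝒯 q) - opA q) := by
  intro w hw
  let y : TestSpace 𝒯 := (⟨w, hw⟩, 0)
  have h := inner_trialToTest v (traceA 𝒯 q) y
  rw [formB_apply, traceA_apply, TestSpace.inner_def, fnLin_trialToTest,
    astarLin_trialToTest] at h
  have e1 : TestSpace.fnLin 𝒯 y = w := rfl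
  have e2 : TestSpace.astarLin 𝒯 y = brokenAstar 𝒯 w := rfl
  have e3 : TestSpace.initLin 𝒯 y = 0 := rfl
  rw [e1, e2, e3] at h
  simp only [inner_zero_right, inner_sub_left] at h ⊢
  linarith

lemma initLin_trialToTest (v q : L2Pair (cylinder T Ω)) :
    TestSpace.initLin 𝒯 (trialToTest 𝒯 v (traceA 𝒯 q)) = initialTrace q := by
  refine ext_inner_right ℝ fun ξ => ?_
  let y : TestSpace 𝒯 := (0, ξ)
  have h := inner_trialToTest v (traceA 𝒯 q) y
  rw [formB_apply, traceA_apply, TestSpace.inner_def] at h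
  have e1 : TestSpace.fnLin 𝒯 y = 0 := rfl
  have e2 : TestSpace.astarLin 𝒯 y = 0 := (brokenAstarLin 𝒯).map_zero
  have e3 : TestSpace.initLin 𝒯 y = ξ := rfl
  rw [e1, e2, e3] at h
  simpa using h

variable (hΩo : IsOpen Ω) (hΩ : Bornology.IsBounded Ω)

-- `E - q` satisfies the relation with `T₁ - A q`, and `q` with `A q`; add the two.
include hΩ in
lemma isGraphU0_extension (v : L2Pair (cylinder T Ω)) {q : L2Pair (cylinder T Ω)}
    (hq : q ∈ spaceU0 (cylinder T Ω)) :
    IsGraphU0 (extension 𝒯 v (traceA 𝒯 q)) (trialToTest₁ 𝒯 v (traceA 𝒯 q)) := by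
  have hQ : Bornology.IsBounded (cylinder T Ω) := isBounded_cylinder hΩ
  have h := ((isAdjointPair_extension_sub (𝒯 := 𝒯) v q).isGraphU0 hQ).add hQ (isGraphU0_opA hq)
  rwa [sub_add_cancel, sub_add_cancel] at h

include hΩo hΩ

lemma opA_extension (v : L2Pair (cylinder T Ω)) {q : L2Pair (cylinder T Ω)}
    (hq : q ∈ spaceU0 (cylinder T Ω)) :
    opA (extension 𝒯 v (traceA 𝒯 q)) = trialToTest₁ 𝒯 v (traceA 𝒯 q) :=
  (isGraphU0_extension hΩ v hq).opA_eq (isOpen_Ioo.prod hΩo)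

lemma initialTrace_extension (v q : L2Pair (cylinder T Ω)) :
    initialTrace (extension 𝒯 v (traceA 𝒯 q)) = initialTrace q :=
  initialTrace_congr <| (isAdjointPair_extension_sub (𝒯 := 𝒯) v q).hasInitialTrace_zero hΩo hΩ

/-- With `A E = T₁` and `γ₀ E = γ₀ q`, the two functionals differ exactly by the two sides of the
adjoint relation. -/
lemma traceA_extension (v : L2Pair (cylinder T Ω)) {q : L2Pair (cylinder T Ω)}
    (hq : q ∈ spaceU0 (cylinder T Ω)) :
    traceA 𝒯 (extension 𝒯 v (traceA 𝒯 q)) = traceA 𝒯 q := by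
  ext y
  have h := isAdjointPair_extension_sub (𝒯 := 𝒯) v q _ y.1.2
  have e1 : TestSpace.fnLin 𝒯 y = y.1 := rfl
  have e2 : TestSpace.astarLin 𝒯 y = brokenAstar 𝒯 y.1 := rfl
  rw [traceA_apply, traceA_apply, initialTrace_extension hΩo hΩ, opA_extension hΩo hΩ v hq, e1, e2]
  simp only [inner_sub_left] at h
  linarith

lemma norm_formB_sq (v : L2Pair (cylinder T Ω)) {q : L2Pair (cylinder T Ω)}
    (hq : q ∈ spaceU0 (cylinder T Ω)) :
    ‖formB 𝒯 v (traceA 𝒯 q)‖ ^ 2 = ‖v - extension 𝒯 v (traceA 𝒯 q)‖ ^ 2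
      + ‖opA (extension 𝒯 v (traceA 𝒯 q))‖ ^ 2
      + ‖initialTrace (extension 𝒯 v (traceA 𝒯 q))‖ ^ 2 := by
  have h : ‖formB 𝒯 v (traceA 𝒯 q)‖ = ‖trialToTest 𝒯 v (traceA 𝒯 q)‖ :=
    ((InnerProductSpace.toDual ℝ (TestSpace 𝒯)).symm.norm_map _).symm
  rw [h, TestSpace.norm_sq_eq, fnLin_trialToTest, astarLin_trialToTest, initLin_trialToTest,
    opA_extension hΩo hΩ v hq, initialTrace_extension hΩo hΩ]
  ring

lemma graphNorm_extension_sq (v : L2Pair (cylinder T Ω)) {q : L2Pair (cylinder T Ω)}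
    (hq : q ∈ spaceU0 (cylinder T Ω)) :
    graphNorm (extension 𝒯 v (traceA 𝒯 q)) ^ 2 = ‖extension 𝒯 v (traceA 𝒯 q)‖ ^ 2
      + ‖trialToTest₁ 𝒯 v (traceA 𝒯 q)‖ ^ 2 := by
  rw [graphNorm, Real.sq_sqrt (by positivity), opA_extension hΩo hΩ v hq]

/-- For `v = 0` one has `A_h^* T₁ = -E`, so testing with `T₁` shows that `E` is orthogonal to `E -
q` in the graph inner product. -/
lemma graphNorm_extension_zero_le {q : L2Pair (cylinder T Ω)}
    (hq : q ∈ spaceU0 (cylinder T Ω)) :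
    graphNorm (extension 𝒯 0 (traceA 𝒯 q)) ≤ graphNorm q := by
  refine Real.sqrt_le_sqrt ?_
  rw [opA_extension hΩo hΩ 0 hq]
  have h := isAdjointPair_extension_sub (𝒯 := 𝒯) 0 q _ (trialToTest₁_mem 0 (traceA 𝒯 q))
  rw [brokenAstar_trialToTest₁, zero_sub, inner_neg_right] at h
  set E := extension 𝒯 0 (traceA 𝒯 q)
  set w := trialToTest₁ 𝒯 0 (traceA 𝒯 q)
  have h1 := norm_sub_sq_real E q
  have h2 := norm_sub_sq_real w (opA q)
  rw [inner_sub_left, inner_sub_left, real_inner_self_eq_norm_sq, real_inner_self_eq_norm_sq,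
    real_inner_comm E q, real_inner_comm w (opA q)] at h
  nlinarith [sq_nonneg ‖E - q‖, sq_nonneg ‖w - opA q‖]

end Extension

/-! ### Linear splitting and orthogonality of `E(0, t)` and `E(v, 0)` -/

section ExtensionSplit

variable {T : ℝ} {Ω : Set (Space d)} {𝒯 : Mesh (cylinder T Ω)}

lemma zero_mem_spaceU0 (hΩo : IsOpen Ω) (hΩ : Bornology.IsBounded Ω) :
    (0 : L2Pair (cylinder T Ω)) ∈ spaceU0 (cylinder T Ω) :=
  (IsGraphU0.zero (isBounded_cylinder hΩ)).mem (isOpen_Ioo.prod hΩo)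

lemma opA_zero (hΩo : IsOpen Ω) (hΩ : Bornology.IsBounded Ω) :
    opA (0 : L2Pair (cylinder T Ω)) = 0 :=
  (IsGraphU0.zero (isBounded_cylinder hΩ)).opA_eq (isOpen_Ioo.prod hΩo)

/-- Makes the results for `t = γ_A q` available for `t = 0`. -/
lemma traceA_zero (hT : 0 < T) (hΩo : IsOpen Ω) (hΩ : Bornology.IsBounded Ω) :
    traceA 𝒯 0 = 0 := by
  ext y
  rw [traceA_apply, opA_zero hΩo hΩ, initialTrace_zero hT]
  simp

lemma trialToTest₁_split (v : L2Pair (cylinder T Ω)) (t : StrongDual ℝ (TestSpace 𝒯)) :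
    trialToTest₁ 𝒯 v t = trialToTest₁ 𝒯 0 t + trialToTest₁ 𝒯 v 0 := by
  have h : trialToTest 𝒯 v t = trialToTest 𝒯 0 t + trialToTest 𝒯 v 0 := by
    refine ext_inner_right ℝ fun y => ?_
    rw [inner_add_left, inner_trialToTest, inner_trialToTest, inner_trialToTest, formB_apply,
      formB_apply, formB_apply, inner_zero_left, zero_add, zero_apply, add_zero,
      add_comm]
  rw [← fnLin_trialToTest, h, map_add]
  rfl

lemma extension_split (v : L2Pair (cylinder T Ω)) (t : StrongDual ℝ (TestSpace 𝒯)) :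
    extension 𝒯 v t = extension 𝒯 0 t + extension 𝒯 v 0 := by
  have h := (brokenAstarLin 𝒯).map_add ⟨_, trialToTest₁_mem 0 t⟩ ⟨_, trialToTest₁_mem v 0⟩
  change brokenAstar 𝒯 (trialToTest₁ 𝒯 0 t + trialToTest₁ 𝒯 v 0) = _ + _ at h
  rw [extension, trialToTest₁_split, h]
  change _ = (0 - brokenAstar 𝒯 (trialToTest₁ 𝒯 0 t)) + (v - brokenAstar 𝒯 (trialToTest₁ 𝒯 v 0))
  change v - (brokenAstar 𝒯 (trialToTest₁ 𝒯 0 t) + brokenAstar 𝒯 (trialToTest₁ 𝒯 v 0)) = _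
  abel

variable (hT : 0 < T) (hΩo : IsOpen Ω) (hΩ : Bornology.IsBounded Ω)
include hT hΩo hΩ

lemma isAdjointPair_extension_zero (v : L2Pair (cylinder T Ω)) :
    IsAdjointPair 𝒯 (extension 𝒯 v 0) (trialToTest₁ 𝒯 v 0) := by
  have h := isAdjointPair_extension_sub (𝒯 := 𝒯) v 0
  rwa [traceA_zero hT hΩo hΩ, opA_zero hΩo hΩ, sub_zero, sub_zero] at h

lemma graphNorm_extension_zero_sq (v : L2Pair (cylinder T Ω)) :
    graphNorm (extension 𝒯 v 0) ^ 2 = ‖extension 𝒯 v 0‖ ^ 2 + ‖trialToTest₁ 𝒯 v 0‖ ^ 2 := by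
  have h := graphNorm_extension_sq (𝒯 := 𝒯) hΩo hΩ v (zero_mem_spaceU0 hΩo hΩ)
  rwa [traceA_zero hT hΩo hΩ] at h

/-- Testing with `T₁` gives `⟨E, v - E⟩ = ‖T₁‖²`, hence `‖v‖² = ‖E‖² + 2‖T₁‖² + ‖v - E‖²`. -/
lemma graphNorm_extension_zero_le_norm (v : L2Pair (cylinder T Ω)) :
    graphNorm (extension 𝒯 v 0) ≤ ‖v‖ := by
  refine (sq_le_sq₀ (show 0 ≤ graphNorm _ from Real.sqrt_nonneg _) (norm_nonneg v)).1 ?_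
  rw [graphNorm_extension_zero_sq hT hΩo hΩ]
  have h := isAdjointPair_extension_zero (𝒯 := 𝒯) hT hΩo hΩ v _ (trialToTest₁_mem v 0)
  rw [brokenAstar_trialToTest₁, real_inner_self_eq_norm_sq] at h
  have h1 := norm_add_sq_real (extension 𝒯 v 0) (v - extension 𝒯 v 0)
  rw [add_sub_cancel, h] at h1
  nlinarith [sq_nonneg ‖v - extension 𝒯 v 0‖, sq_nonneg ‖trialToTest₁ 𝒯 v 0‖]

/-- The adjoint pair of `(v, 0)`, tested with `T₁(0, t)`, says that `E(v, 0)` and `E(0, t)` are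
orthogonal in the graph inner product. -/
lemma graphNorm_extension_sq_eq_add (v : L2Pair (cylinder T Ω)) {q : L2Pair (cylinder T Ω)}
    (hq : q ∈ spaceU0 (cylinder T Ω)) :
    graphNorm (extension 𝒯 v (traceA 𝒯 q)) ^ 2
      = graphNorm (extension 𝒯 0 (traceA 𝒯 q)) ^ 2 + graphNorm (extension 𝒯 v 0) ^ 2 := by
  rw [graphNorm_extension_sq hΩo hΩ v hq, graphNorm_extension_sq hΩo hΩ 0 hq,
    graphNorm_extension_zero_sq hT hΩo hΩ]
  have h := isAdjointPair_extension_zero (𝒯 := 𝒯) hT hΩo hΩ v _ (trialToTest₁_mem 0 (traceA 𝒯 q))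
  rw [brokenAstar_trialToTest₁, zero_sub, inner_neg_right, real_inner_comm,
    real_inner_comm (trialToTest₁ 𝒯 0 (traceA 𝒯 q))] at h
  rw [extension_split, trialToTest₁_split, norm_add_sq_real, norm_add_sq_real, ← h]
  ring

end ExtensionSplit

end HeatDPG

end

theorem mainTheorem4 {d : ℕ} (hd : 1 ≤ d) {T : ℝ} (hT : 0 < T)
    {Ω : Set (HeatDPG.Space d)} (hΩ : HeatDPG.IsBoundedLipschitzDomain Ω)
    (𝒯 : HeatDPG.Mesh (HeatDPG.cylinder T Ω))
    (v : HeatDPG.L2Pair (HeatDPG.cylinder T Ω))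
    (t : StrongDual ℝ (HeatDPG.TestSpace 𝒯)) (ht : t ∈ HeatDPG.traceSpace 𝒯) :
    (HeatDPG.extension 𝒯 v t ∈ HeatDPG.spaceU0 (HeatDPG.cylinder T Ω) ∧
      HeatDPG.opA (HeatDPG.extension 𝒯 v t) = HeatDPG.trialToTest₁ 𝒯 v t) ∧
    HeatDPG.traceA 𝒯 (HeatDPG.extension 𝒯 v t) = t ∧
    ‖HeatDPG.formB 𝒯 v t‖ ^ 2 =
      ‖v - HeatDPG.extension 𝒯 v t‖ ^ 2 + ‖HeatDPG.opA (HeatDPG.extension 𝒯 v t)‖ ^ 2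
        + ‖HeatDPG.initialTrace (HeatDPG.extension 𝒯 v t)‖ ^ 2 ∧
    IsLeast (HeatDPG.graphNorm ''
        {q | q ∈ HeatDPG.spaceU0 (HeatDPG.cylinder T Ω) ∧ HeatDPG.traceA 𝒯 q = t})
      (HeatDPG.graphNorm (HeatDPG.extension 𝒯 0 t)) ∧
    HeatDPG.graphNorm (HeatDPG.extension 𝒯 v 0) ≤ ‖v‖ ∧
    HeatDPG.graphNorm (HeatDPG.extension 𝒯 v t) ^ 2 =
      HeatDPG.graphNorm (HeatDPG.extension 𝒯 0 t) ^ 2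
        + HeatDPG.graphNorm (HeatDPG.extension 𝒯 v 0) ^ 2 := by
  have ho := hΩ.isOpen
  have hb := hΩ.isBounded
  have hQo : IsOpen (HeatDPG.cylinder T Ω) := isOpen_Ioo.prod ho
  obtain ⟨q, hq, rfl⟩ := ht
  refine ⟨⟨(HeatDPG.isGraphU0_extension hb v hq).mem hQo, HeatDPG.opA_extension ho hb v hq⟩,
    HeatDPG.traceA_extension ho hb v hq, HeatDPG.norm_formB_sq ho hb v hq, ⟨?_, ?_⟩,
    HeatDPG.graphNorm_extension_zero_le_norm hT ho hb v,
    HeatDPG.graphNorm_extension_sq_eq_add hT ho hb v hq⟩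
  · exact ⟨_, ⟨(HeatDPG.isGraphU0_extension hb 0 hq).mem hQo,
      HeatDPG.traceA_extension ho hb 0 hq⟩, rfl⟩
  · rintro _ ⟨p, ⟨hp, hpq⟩, rfl⟩
    -- The competitor `p` is itself a preimage of `t`, so it can play the role of `q` in the
    -- orthogonality argument.
    rw [← hpq]
    exact HeatDPG.graphNorm_extension_zero_le ho hb hp
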